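/- For a partition $\lambda$, written $\lambda_1\ge\lambda_2\ge\dots\ge\lambda_\ell\ge 1$ and drawn as a left-justified diagram with $\lambda_i$ boxes in row $i$, the hook number of a box is the number of boxes weakly to its right in its row plus the number of boxes strictly below it in its column. A hook of length $h$ of $\lambda$ is a box of $\lambda$ with hook number $h$. For an integer $h\ge 1$ put $$\alpha_h=\sum_{j=0}^{\lceil h/2\rceil-1}\binom{h-j-1}{j}I_A(j,2h-4j)+\sum_{j=0}^{\lfloor h/2\rfloor-1}\binom{h-j-2}{j}I_A(j,2h-4j-2),\qquad \beta_h=\sum_{j=0}^{\lceil h/2\rceil-1}\binom{h-j-1}{j}I_B(j+1,h-j),$$ where $$I_A(j,l)=\int_0^\infty(1-e^{-2x})^j e^{-lx}\,dx,\qquad I_B(j,k)=\int_0^\infty\frac{e^{-jx}}{(1+e^{-x})^k}\,dx.$$ Let $\mathrm{avg}_{\mathcal O}(h;n)$ and $\mathrm{avg}_{\mathcal D}(h;n)$ be the average number of hooks of length $h$ among the partitions of $n$ into odd parts and among the partitions of $n$ into distinct parts, respectively (that is, the total number of hooks of length $h$ in these partitions divided by the number of these partitions). Then, for every fixed integer $h\ge1$,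 $$\mathrm{avg}_{\mathcal O}(h;n)\sim\frac{6\alpha_h}{\pi}\sqrt{\frac n3},\qquad \mathrm{avg}_{\mathcal D}(h;n)\sim\frac{6\beta_h}{\pi}\sqrt{\frac n3}\qquad\text{as } n\to\infty.$$ -/

import Mathlib

/-- The Ferrers (Young) diagram of a partition: its rows, from top to bottom, are the parts in
weakly decreasing order. The cell in row `i` and column `j` (both counted from `0`) is `(i, j)`. -/
def Nat.Partition.ferrers {n : ℕ} (p : n.Partition) : YoungDiagram :=
  YoungDiagram.ofRowLens (p.parts.sort (· ≥ ·)) (p.parts.pairwise_sort (· ≥ ·)).sortedGE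

/-- The arm length of a cell: the number of cells to the right of it in its row. -/
def YoungDiagram.armLength (μ : YoungDiagram) (c : ℕ × ℕ) : ℕ := μ.rowLen c.1 - (c.2 + 1)

/-- The leg length of a cell: the number of cells below it in its column. -/
def YoungDiagram.legLength (μ : YoungDiagram) (c : ℕ × ℕ) : ℕ := μ.colLen c.2 - (c.1 + 1)

/-- The hook number of a cell: the number of cells of the L-shape formed by the cell, the cells to
the right of it and the cells below it. -/
def YoungDiagram.hookNumber (μ : YoungDiagram) (c : ℕ × ℕ) : ℕ :=
  μ.armLength c + μ.legLength c + 1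

/-- The number of hooks of length `h` in a partition, that is, the multiplicity of `h` in its
multiset of hook numbers. -/
def Nat.Partition.hookCount {n : ℕ} (p : n.Partition) (h : ℕ) : ℕ :=
  (p.ferrers.cells.filter fun c => p.ferrers.hookNumber c = h).card

/-- The average number of hooks of length `h` among the partitions in a finite set of partitions
of `n`. -/
noncomputable def avgHooks {n : ℕ} (S : Finset n.Partition) (h : ℕ) : ℝ :=
  (∑ p ∈ S, (p.hookCount h : ℝ)) / (S.card : ℝ)

/-- `∫_0^∞ (1 - e^{-2x})^j e^{-lx} dx`; it converges for `l ≥ 1`. -/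
noncomputable def integralA (j l : ℕ) : ℝ :=
  ∫ x in Set.Ioi (0 : ℝ), (1 - Real.exp (-2 * x)) ^ j * Real.exp (-(l : ℝ) * x)

/-- `∫_0^∞ e^{-jx} / (1 + e^{-x})^k dx`; it converges for `j ≥ 1`. -/
noncomputable def integralB (j k : ℕ) : ℝ :=
  ∫ x in Set.Ioi (0 : ℝ), Real.exp (-(j : ℝ) * x) / (1 + Real.exp (-x)) ^ k

/-- The constant `α_h`. The index `j` runs over `0 ≤ j ≤ ⌈h/2⌉ - 1` in the first sum and over
`0 ≤ j ≤ ⌊h/2⌋ - 1` in the second; no natural-number subtraction truncates in these ranges. -/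
noncomputable def hookAlpha (h : ℕ) : ℝ :=
  (∑ j ∈ Finset.range ((h + 1) / 2),
      ((h - j - 1).choose j : ℝ) * integralA j (2 * h - 4 * j)) +
    ∑ j ∈ Finset.range (h / 2),
      ((h - j - 2).choose j : ℝ) * integralA j (2 * h - 4 * j - 2)

/-- The constant `β_h`. The index `j` runs over `0 ≤ j ≤ ⌈h/2⌉ - 1`. -/
noncomputable def hookBeta (h : ℕ) : ℝ :=
  ∑ j ∈ Finset.range ((h + 1) / 2),
    ((h - j - 1).choose j : ℝ) * integralB (j + 1) (h - j)

/-! Fix an arm length `a` and put `l = h - a - 1`. Column `j` contains at most one cell with arm `a`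
and leg `l`. It contains one exactly when, listing the parts in `[j+1, j+a]` followed by the copies
of `m = j+a+1`, the entry of index `l` is a copy of `m` (`HookProp`, `Nat.Partition.hookCount_eq`).
Hence the total number of hooks is a sum over `a` and `j` of counts of partitions subject to a
condition on parts near `j`.

The analytic input is `tendsto_oddRatio`: lowering the size by `k ~ y√n` multiplies the number of
partitions into odd parts by `e^{-cy}` in the limit, `c = π/(2√3)`. No asymptotic formula for that
number is used. Counting total size in two ways gives a recurrence and, from it, an exponential tail
bound (`oddRatio_le_exp`). Helly selection gives subsequential limits `v` of the ratios, and the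
recurrence becomes `v(y) = c² ∫ w v(y+w) dw` (`limit_renewal`), whose only admissible solution is
`e^{-cy}` (`eq_exp_of_renewal`). By Euler's theorem the same ratios serve for distinct parts.

So erasing one part near `y√n` costs a factor `x = e^{-cy}`. Growing the window one integer at a
time gives the limiting proportions `C(l+b, l) x^{l+1} (1-x)^b` for odd parts, with `b` odd integers
in the window, and `C(a, l) x^{l+1} / (1+x)^{a+1}` for distinct parts (`hasShiftLim_oddHook`,
`hasShiftLim_distinctHook`). The sum over `j` is a Riemann sum of mesh `1/√n`, dominated through the
tail bound, and its limit is a multiple of `integralA` or `integralB`. -/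

open Filter Topology MeasureTheory

/-! ### Counting partitions of `n - k` and removing parts -/

/-- The multisets of positive integers with sum `n - k` that satisfy `P`. -/
def partsSet (P : Multiset ℕ → Prop) (n k : ℕ) : Set (Multiset ℕ) :=
  {s | (∀ i ∈ s, 0 < i) ∧ s.sum + k = n ∧ P s}

/-- The number of partitions of `n - k` whose multiset of parts satisfies `P`; it is `0` for
`n < k`. -/
noncomputable def pcount (P : Multiset ℕ → Prop) (n k : ℕ) : ℕ := (partsSet P n k).ncard

lemma partsSet_finite (P : Multiset ℕ → Prop) (n k : ℕ) : (partsSet P n k).Finite := by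
  refine (Set.finite_range fun p : (n - k).Partition => p.parts).subset ?_
  rintro s ⟨hs, hsum, -⟩
  exact ⟨⟨s, fun {i} hi => hs i hi, by omega⟩, rfl⟩

lemma pcount_congr {P P' : Multiset ℕ → Prop} (n k : ℕ)
    (hP : ∀ s, (∀ i ∈ s, 0 < i) → (P s ↔ P' s)) : pcount P n k = pcount P' n k := by
  unfold pcount
  congr 1
  ext s
  simp only [partsSet, Set.mem_ofPred_eq]
  constructor
  · rintro ⟨h1, h2, h3⟩; exact ⟨h1, h2, (hP s h1).1 h3⟩
  · rintro ⟨h1, h2, h3⟩; exact ⟨h1, h2, (hP s h1).2 h3⟩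

lemma pcount_mono {P P' : Multiset ℕ → Prop} (n k : ℕ) (hP : ∀ s, P s → P' s) :
    pcount P n k ≤ pcount P' n k :=
  Set.ncard_le_ncard (fun _ hs => ⟨hs.1, hs.2.1, hP _ hs.2.2⟩) (partsSet_finite _ _ _)

lemma pcount_split (P R : Multiset ℕ → Prop) (n k : ℕ) :
    pcount P n k = pcount (fun s => P s ∧ R s) n k + pcount (fun s => P s ∧ ¬ R s) n k := by
  unfold pcount
  rw [← Set.ncard_union_eq _ (partsSet_finite _ _ _) (partsSet_finite _ _ _)]
  · congr 1
    ext s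
    simp only [partsSet, Set.mem_ofPred_eq, Set.mem_union]
    tauto
  · rw [Set.disjoint_left]
    rintro s ⟨-, -, -, h⟩ ⟨-, -, -, h'⟩
    exact h' h

/-- Erasing one copy of `i` is a bijection. Every recursion below rests on this; carrying the
removed size in `k` avoids truncated subtraction. -/
lemma pcount_mem (P : Multiset ℕ → Prop) {i : ℕ} (hi : 0 < i) (n k : ℕ) :
    pcount (fun s => P s ∧ i ∈ s) n k = pcount (fun s => P (i ::ₘ s)) n (k + i) := by
  unfold pcount
  rw [← Set.ncard_image_of_injective (partsSet (fun s => P (i ::ₘ s)) n (k + i))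
    (fun a b h => (Multiset.cons_inj_right i).1 h)]
  congr 1
  ext s
  simp only [partsSet, Set.mem_ofPred_eq, Set.mem_image]
  constructor
  · rintro ⟨h1, h2, h3, h4⟩
    obtain ⟨t, rfl⟩ := Multiset.exists_cons_of_mem h4
    refine ⟨t, ⟨fun j hj => h1 j (Multiset.mem_cons_of_mem hj), ?_, h3⟩, rfl⟩
    rw [Multiset.sum_cons] at h2
    omega
  · rintro ⟨t, ⟨h1, h2, h3⟩, rfl⟩
    refine ⟨?_, ?_, h3, Multiset.mem_cons_self _ _⟩
    · intro j hj
      rcases Multiset.mem_cons.1 hj with rfl | hj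
      · exact hi
      · exact h1 j hj
    · rw [Multiset.sum_cons]; omega

lemma pcount_eq_zero (P : Multiset ℕ → Prop) {n k : ℕ} (h : n < k) : pcount P n k = 0 := by
  unfold pcount
  convert Set.ncard_empty (Multiset ℕ)
  ext s
  simp only [partsSet, Set.mem_ofPred_eq, Set.mem_empty_iff_false, iff_false]
  rintro ⟨-, h2, -⟩
  omega

/-! ### Partitions into odd parts: recurrence and tail bound -/

/-- All elements of the multiset are odd. -/
def AllOdd (s : Multiset ℕ) : Prop := ∀ i ∈ s, Odd i

lemma allOdd_cons {i : ℕ} (hi : Odd i) (s : Multiset ℕ) : AllOdd (i ::ₘ s) ↔ AllOdd s := by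
  simp [AllOdd, hi]

lemma pcount_allOdd_le_count {m : ℕ} (hm : Odd m) (j n k : ℕ) :
    pcount (fun s => AllOdd s ∧ j ≤ s.count m) n k = pcount AllOdd n (k + j * m) := by
  induction j generalizing k with
  | zero => simp
  | succ j ih =>
    have h1 : pcount (fun s => AllOdd s ∧ j + 1 ≤ s.count m) n k =
        pcount (fun s => (AllOdd s ∧ j + 1 ≤ s.count m) ∧ m ∈ s) n k := by
      refine pcount_congr _ _ fun s _ => ⟨fun h => ⟨h, ?_⟩, fun h => h.1⟩
      exact Multiset.count_pos.1 (by omega)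
    rw [h1, pcount_mem (fun s => AllOdd s ∧ j + 1 ≤ s.count m) hm.pos]
    have h2 : pcount (fun s => AllOdd (m ::ₘ s) ∧ j + 1 ≤ (m ::ₘ s).count m) n (k + m) =
        pcount (fun s => AllOdd s ∧ j ≤ s.count m) n (k + m) := by
      refine pcount_congr _ _ fun s _ => ?_
      rw [allOdd_cons hm, Multiset.count_cons_self]
      simp
    rw [h2, ih]
    congr 1
    ring

/-- Since 1 is odd, adjoining a part 1 injects the partitions of `n - k - 1` into those of `n - k`.
-/
lemma pcount_allOdd_antitone (n : ℕ) : Antitone (pcount AllOdd n) := by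
  refine antitone_nat_of_succ_le fun k => ?_
  have h := pcount_mem AllOdd one_pos n k
  have h2 : pcount (fun s => AllOdd (1 ::ₘ s)) n (k + 1) = pcount AllOdd n (k + 1) :=
    pcount_congr _ _ fun s _ => allOdd_cons odd_one s
  rw [← h2, ← h]
  exact pcount_mono _ _ fun s hs => hs.1

lemma pcount_allOdd_pos (n : ℕ) : 0 < pcount AllOdd n 0 := by
  unfold pcount
  rw [Set.ncard_pos (partsSet_finite _ _ _)]
  refine ⟨Multiset.replicate n 1, ?_, by simp, ?_⟩
  · intro i hi
    rw [Multiset.eq_of_mem_replicate hi]; exact one_pos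
  · intro i hi
    rw [Multiset.eq_of_mem_replicate hi]; exact odd_one

lemma Multiset.card_le_sum_of_pos {s : Multiset ℕ} (h : ∀ i ∈ s, 0 < i) : s.card ≤ s.sum := by
  have := Multiset.card_nsmul_le_sum (s := s) (a := 1) (fun i hi => h i hi)
  simpa using this

lemma AllOdd.sum_eq {s : Multiset ℕ} (hs : AllOdd s) {n : ℕ} (hn : s.sum ≤ n) :
    s.sum = ∑ r ∈ Finset.range (n + 1), (2 * r + 1) * s.count (2 * r + 1) := by
  rw [Finset.sum_multiset_count]
  rw [← Finset.sum_image (s := Finset.range (n + 1)) (g := fun r => 2 * r + 1)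
    (f := fun m => m * s.count m) (by intro a _ b _ h; simpa using h)]
  refine (Finset.sum_subset ?_ ?_).trans (Finset.sum_congr rfl fun m _ => ?_)
  · intro m hm
    rw [Multiset.mem_toFinset] at hm
    obtain ⟨r, rfl⟩ := hs m hm
    have := Multiset.le_sum_of_mem hm
    exact Finset.mem_image.2 ⟨r, Finset.mem_range.2 (by omega), rfl⟩
  · intro m _ hm
    rw [Multiset.mem_toFinset] at hm
    simp [Multiset.count_eq_zero_of_notMem hm]
  · rw [smul_eq_mul, mul_comm]

lemma pcount_eq_sum_ite (P R : Multiset ℕ → Prop) [DecidablePred R] (n k : ℕ) :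
    pcount (fun s => P s ∧ R s) n k =
      ∑ s ∈ (partsSet_finite P n k).toFinset, if R s then 1 else 0 := by
  rw [Finset.sum_boole, Nat.cast_id, pcount, ← Set.ncard_coe_finset]
  congr 1
  ext s
  simp [partsSet, and_assoc]

/-- Counting the size of all partitions of `n - k` into odd parts in two ways. -/
lemma sub_mul_pcount_allOdd (n k : ℕ) (hk : k ≤ n) :
    (n - k) * pcount AllOdd n k = ∑ j ∈ Finset.range n, ∑ r ∈ Finset.range (n + 1),
      (2 * r + 1) * pcount AllOdd n (k + (j + 1) * (2 * r + 1)) := by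
  have h1 : ∀ j r : ℕ, pcount AllOdd n (k + (j + 1) * (2 * r + 1)) =
      ∑ s ∈ (partsSet_finite AllOdd n k).toFinset, if j + 1 ≤ s.count (2 * r + 1) then 1 else 0 := by
    intro j r
    rw [← pcount_allOdd_le_count (by exact ⟨r, rfl⟩), pcount_eq_sum_ite]
  simp_rw [h1, Finset.mul_sum]
  rw [Finset.sum_comm]
  have h2 : ∀ r : ℕ, ∑ j ∈ Finset.range n, ∑ s ∈ (partsSet_finite AllOdd n k).toFinset,
      (2 * r + 1) * (if j + 1 ≤ s.count (2 * r + 1) then 1 else 0) =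
      ∑ s ∈ (partsSet_finite AllOdd n k).toFinset, (2 * r + 1) * s.count (2 * r + 1) := by
    intro r
    rw [Finset.sum_comm]
    refine Finset.sum_congr rfl fun s hs => ?_
    rw [← Finset.mul_sum]
    congr 1
    rw [Finset.sum_boole, Nat.cast_id]
    have hs' : s ∈ partsSet AllOdd n k := by simpa using hs
    have hc : s.count (2 * r + 1) ≤ n :=
      (Multiset.count_le_card _ _).trans
        ((Multiset.card_le_sum_of_pos hs'.1).trans (by have := hs'.2.1; omega))
    have : (Finset.range n).filter (fun j => j + 1 ≤ s.count (2 * r + 1)) =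
        Finset.range (s.count (2 * r + 1)) := by
      ext j; simp only [Finset.mem_filter, Finset.mem_range]; omega
    rw [this, Finset.card_range]
  rw [Finset.sum_congr rfl fun r _ => h2 r, Finset.sum_comm, pcount,
    Set.ncard_eq_toFinset_card _ (partsSet_finite AllOdd n k), mul_comm, ← smul_eq_mul,
    ← Finset.sum_const]
  refine Finset.sum_congr rfl fun s hs => ?_
  have hs' : s ∈ partsSet AllOdd n k := by simpa using hs
  have h3 := hs'.2.1
  rw [← AllOdd.sum_eq hs'.2.2 (by omega)]
  omega

/-- Keep only the terms `j = 0`, `r < R` of the recurrence, bound each from below by monotonicity,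
and use that the first `R` odd numbers sum to `R²`. -/
lemma sq_mul_pcount_allOdd_le (n k R : ℕ) :
    R ^ 2 * pcount AllOdd n (k + 2 * R) ≤ n * pcount AllOdd n k := by
  rcases lt_or_ge n (k + 2 * R) with h | h
  · simp [pcount_eq_zero _ h]
  rcases Nat.eq_zero_or_pos R with rfl | hR
  · simp
  have hodd : ∀ R : ℕ, ∑ r ∈ Finset.range R, (2 * r + 1) = R ^ 2 := by
    intro R
    induction R with
    | zero => rfl
    | succ R ih => rw [Finset.sum_range_succ, ih]; ring
  calc R ^ 2 * pcount AllOdd n (k + 2 * R)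
      = ∑ r ∈ Finset.range R, (2 * r + 1) * pcount AllOdd n (k + 2 * R) := by
        rw [← Finset.sum_mul, hodd]
    _ ≤ ∑ r ∈ Finset.range R, (2 * r + 1) * pcount AllOdd n (k + (0 + 1) * (2 * r + 1)) := by
        refine Finset.sum_le_sum fun r hr => Nat.mul_le_mul_left _ (pcount_allOdd_antitone n ?_)
        have := Finset.mem_range.1 hr
        omega
    _ ≤ ∑ r ∈ Finset.range (n + 1), (2 * r + 1) * pcount AllOdd n (k + (0 + 1) * (2 * r + 1)) :=
        Finset.sum_le_sum_of_subset (Finset.range_subset_range.2 (by omega))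
    _ ≤ ∑ j ∈ Finset.range n, ∑ r ∈ Finset.range (n + 1),
          (2 * r + 1) * pcount AllOdd n (k + (j + 1) * (2 * r + 1)) :=
        Finset.single_le_sum (f := fun j => ∑ r ∈ Finset.range (n + 1),
          (2 * r + 1) * pcount AllOdd n (k + (j + 1) * (2 * r + 1)))
          (fun _ _ => Nat.zero_le _) (Finset.mem_range.2 (by omega))
    _ = (n - k) * pcount AllOdd n k := (sub_mul_pcount_allOdd n k (by omega)).symm
    _ ≤ n * pcount AllOdd n k := Nat.mul_le_mul_right _ (Nat.sub_le _ _)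

/-- The number of partitions of `n - k` into odd parts, divided by that of `n`. -/
noncomputable def oddRatio (n k : ℕ) : ℝ := pcount AllOdd n k / pcount AllOdd n 0

lemma oddRatio_nonneg (n k : ℕ) : 0 ≤ oddRatio n k := by unfold oddRatio; positivity

lemma oddRatio_antitone (n : ℕ) : Antitone (oddRatio n) := by
  intro a b h
  unfold oddRatio
  have := pcount_allOdd_antitone n h
  gcongr

lemma oddRatio_zero (n : ℕ) : oddRatio n 0 = 1 :=
  div_self (by exact_mod_cast (pcount_allOdd_pos n).ne')

lemma oddRatio_le_one (n k : ℕ) : oddRatio n k ≤ 1 :=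
  (oddRatio_antitone n (Nat.zero_le k)).trans_eq (oddRatio_zero n)

lemma oddRatio_eq_zero {n k : ℕ} (h : n < k) : oddRatio n k = 0 := by
  simp [oddRatio, pcount_eq_zero _ h]

/-- Each shift by a fixed multiple of `√n` divides the ratio by at least 4, hence by more than `e`;
iterating gives exponential decay. The factor 3 absorbs the rounding of `k` to a multiple of the
step. -/
lemma oddRatio_le_exp (n k : ℕ) : oddRatio n k ≤ 3 * Real.exp (-(k / (8 * √n))) := by
  have he1 : Real.exp 1 < 3 := Real.exp_one_lt_d9.trans (by norm_num)
  rcases Nat.eq_zero_or_pos n with rfl | hn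
  · simp only [Nat.cast_zero, Real.sqrt_zero, mul_zero, div_zero, neg_zero, Real.exp_zero, mul_one]
    exact (oddRatio_le_one _ _).trans (by norm_num)
  -- Chosen so that `R² ≥ 4n`, while the step `2R` stays at most `8√n`.
  set R := 2 * (Nat.sqrt n + 1) with hR
  have hRn : 4 * n ≤ R ^ 2 := by
    have := Nat.lt_succ_sqrt n
    rw [Nat.succ_eq_add_one] at this
    nlinarith
  have hstep : ∀ k, oddRatio n (k + 2 * R) * Real.exp 1 ≤ oddRatio n k := by
    intro k
    have h1 := sq_mul_pcount_allOdd_le n k R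
    have h2 : 4 * pcount AllOdd n (k + 2 * R) ≤ pcount AllOdd n k := by
      have : n * (4 * pcount AllOdd n (k + 2 * R)) ≤ n * pcount AllOdd n k := by
        refine le_trans ?_ h1
        nlinarith [Nat.mul_le_mul_right (pcount AllOdd n (k + 2 * R)) hRn]
      exact Nat.le_of_mul_le_mul_left this hn
    have h3 : (4 : ℝ) * pcount AllOdd n (k + 2 * R) ≤ pcount AllOdd n k := by exact_mod_cast h2
    have h4 : 4 * oddRatio n (k + 2 * R) ≤ oddRatio n k := by
      unfold oddRatio
      rw [← mul_div_assoc]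
      gcongr
    nlinarith [oddRatio_nonneg n (k + 2 * R)]
  have hiter : ∀ i, oddRatio n (i * (2 * R)) ≤ Real.exp (-(i : ℝ)) := by
    intro i
    induction i with
    | zero => simp [oddRatio_zero]
    | succ i ih =>
      have h1 := (hstep (i * (2 * R))).trans ih
      rw [add_mul, one_mul]
      push_cast
      rw [neg_add, Real.exp_add, Real.exp_neg 1, ← div_eq_mul_inv, le_div_iff₀ (Real.exp_pos 1)]
      exact h1
  have hR0 : 0 < 2 * R := by omega
  have h1 : oddRatio n k ≤ Real.exp (-((k / (2 * R) : ℕ) : ℝ)) :=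
    (oddRatio_antitone n (Nat.div_mul_le_self k (2 * R))).trans (hiter _)
  refine h1.trans ?_
  have h2 : (k : ℝ) / (8 * √n) ≤ ((k / (2 * R) : ℕ) : ℝ) + 1 := by
    have h3 : k < 2 * R * (k / (2 * R) + 1) := Nat.lt_mul_div_succ k hR0
    have h4 : (k : ℝ) ≤ 2 * R * (((k / (2 * R) : ℕ) : ℝ) + 1) := by exact_mod_cast h3.le
    have hs1 : (1 : ℝ) ≤ √n := Real.one_le_sqrt.2 (by exact_mod_cast hn)
    have hs2 : (Nat.sqrt n : ℝ) ≤ √n := Real.nat_sqrt_le_real_sqrt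
    have h5 : (2 * R : ℝ) ≤ 8 * √n := by rw [hR]; push_cast; linarith
    rw [div_le_iff₀ (by positivity)]
    refine h4.trans ?_
    rw [mul_comm]
    gcongr
  calc Real.exp (-((k / (2 * R) : ℕ) : ℝ)) ≤ Real.exp (1 + -(k / (8 * √n))) := by
        apply Real.exp_le_exp.2; linarith
    _ = Real.exp 1 * Real.exp (-(k / (8 * √n))) := Real.exp_add _ _
    _ ≤ _ := by gcongr

lemma sub_mul_oddRatio (n k : ℕ) (hk : k ≤ n) :
    ((n : ℝ) - k) * oddRatio n k = ∑ j ∈ Finset.range n, ∑ r ∈ Finset.range (n + 1),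
      (2 * r + 1 : ℝ) * oddRatio n (k + (j + 1) * (2 * r + 1)) := by
  have h := congrArg (Nat.cast (R := ℝ)) (sub_mul_pcount_allOdd n k hk)
  push_cast [hk] at h
  unfold oddRatio
  rw [← mul_div_assoc, h, Finset.sum_div]
  refine Finset.sum_congr rfl fun j _ => ?_
  rw [Finset.sum_div]
  refine Finset.sum_congr rfl fun r _ => ?_
  rw [mul_div_assoc]

/-! ### Riemann sums as integrals of step functions -/

lemma integral_comp_natFloor_mul {g : ℕ → ℝ} {t : ℝ} (ht : 0 < t) (N : ℕ)
    (hg : ∀ m, N ≤ m → g m = 0) :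
    ∫ y in Set.Ioi (0 : ℝ), g ⌊y * t⌋₊ = t⁻¹ * ∑ m ∈ Finset.range N, g m := by
  rw [integral_comp_mul_right_Ioi (fun y => g ⌊y⌋₊) 0 ht, zero_mul, smul_eq_mul,
    ← integral_Ici_eq_integral_Ioi]
  congr 1
  have h1 : ∀ y ∈ Set.Ici (0 : ℝ), g ⌊y⌋₊ = ∑ m ∈ Finset.range N,
      (Set.Ico (m : ℝ) (m + 1)).indicator (fun _ => g m) y := by
    intro y hy
    by_cases hN : ⌊y⌋₊ < N
    · rw [Finset.sum_eq_single_of_mem _ (Finset.mem_range.2 hN), Set.indicator_of_mem]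
      · exact ⟨Nat.floor_le hy, Nat.lt_floor_add_one y⟩
      · intro m _ hm
        rw [Set.indicator_of_notMem]
        rintro ⟨h1, h2⟩
        exact hm ((Nat.floor_eq_iff hy).2 ⟨h1, h2⟩).symm
    · rw [hg _ (not_lt.1 hN), Finset.sum_eq_zero]
      intro m hm
      rw [Set.indicator_of_notMem]
      rintro ⟨h1, h2⟩
      rw [(Nat.floor_eq_iff hy).2 ⟨h1, h2⟩] at hN
      exact hN (Finset.mem_range.1 hm)
  rw [setIntegral_congr_fun measurableSet_Ici h1, integral_finsetSum]
  · refine Finset.sum_congr rfl fun m _ => ?_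
    rw [setIntegral_indicator measurableSet_Ico, setIntegral_const,
      Set.inter_eq_right.2 fun x hx => Set.mem_Ici.2 (le_trans (Nat.cast_nonneg m) hx.1)]
    simp
  · intro m _
    refine (IntegrableOn.integrable_indicator ?_ measurableSet_Ico).integrableOn
    exact integrableOn_const (by simp)

/-- Convergence of Riemann sums with mesh `1 / t i`, by dominated convergence. -/
lemma tendsto_riemannSum {t : ℕ → ℝ} (ht : ∀ᶠ i in atTop, 0 < t i) {F : ℕ → ℕ → ℝ} {N : ℕ → ℕ}
    (hF : ∀ i m, N i ≤ m → F i m = 0) {φ bound : ℝ → ℝ} (hb : IntegrableOn bound (Set.Ioi 0))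
    (hbd : ∀ᶠ i in atTop, ∀ y, 0 < y → |F i ⌊y * t i⌋₊| ≤ bound y)
    (hlim : ∀ᵐ y, 0 < y → Tendsto (fun i => F i ⌊y * t i⌋₊) atTop (𝓝 (φ y))) :
    Tendsto (fun i => (t i)⁻¹ * ∑ m ∈ Finset.range (N i), F i m) atTop
      (𝓝 (∫ y in Set.Ioi (0 : ℝ), φ y)) := by
  have h1 : Tendsto (fun i => ∫ y in Set.Ioi (0 : ℝ), F i ⌊y * t i⌋₊) atTop
      (𝓝 (∫ y in Set.Ioi (0 : ℝ), φ y)) := by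
    refine tendsto_integral_filter_of_dominated_convergence bound ?_ ?_ hb ?_
    · refine Eventually.of_forall fun i => Measurable.aestronglyMeasurable ?_
      exact (measurable_from_nat).comp (Nat.measurable_floor.comp (measurable_id.mul_const _))
    · filter_upwards [hbd] with i hi
      exact (ae_restrict_iff' measurableSet_Ioi).2 (Eventually.of_forall fun y hy => hi y hy)
    · exact (ae_restrict_iff' measurableSet_Ioi).2 hlim
  refine h1.congr' ?_
  filter_upwards [ht] with i hi
  exact integral_comp_natFloor_mul hi (N i) (hF i)

lemma tendsto_natFloor_mul_div {t : ℕ → ℝ} (ht : Tendsto t atTop atTop) {y : ℝ} (hy : 0 ≤ y) :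
    Tendsto (fun i => (⌊y * t i⌋₊ : ℝ) / t i) atTop (𝓝 y) :=
  (tendsto_nat_floor_mul_div_atTop hy).comp ht

/-! ### The renewal equation -/

/-- A bounded continuous solution of the renewal equation with kernel `c² w` is `e^{-cy}`. -/
lemma eq_exp_of_renewal {c : ℝ} (hc : 0 < c) {v : ℝ → ℝ} (hv0 : ∀ y, 0 ≤ v y)
    (hint : IntegrableOn v (Set.Ioi 0)) (hint1 : IntegrableOn (fun s => s * v s) (Set.Ioi 0))
    (hae : ∀ᵐ y, 0 < y → v y = c ^ 2 * ∫ w in Set.Ioi (0 : ℝ), w * v (y + w))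
    (h0 : 1 = c ^ 2 * ∫ w in Set.Ioi (0 : ℝ), w * v (0 + w)) {y : ℝ} (hy : 0 ≤ y) :
    c ^ 2 * ∫ w in Set.Ioi (0 : ℝ), w * v (y + w) = Real.exp (-c * y) := by
  set A0 := ∫ s in Set.Ioi (0 : ℝ), s * v s with hA0
  set B0 := ∫ s in Set.Ioi (0 : ℝ), v s with hB0
  have hsub : ∀ y : ℝ, 0 ≤ y → Set.Ioi y ⊆ Set.Ioi 0 := fun y hy => Set.Ioi_subset_Ioi hy
  -- the value of the integral through tails
  have htail : ∀ y : ℝ, 0 ≤ y → ∫ w in Set.Ioi (0 : ℝ), w * v (y + w) =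
      (∫ s in Set.Ioi y, s * v s) - y * ∫ s in Set.Ioi y, v s := by
    intro y hy
    have h1 := (measurePreserving_add_left volume y).setIntegral_preimage_emb
      (measurableEmbedding_addLeft y) (fun s => (s - y) * v s) (Set.Ioi y)
    rw [Set.preimage_const_add_Ioi, sub_self] at h1
    have h2 : (fun w => w * v (y + w)) = fun w => (y + w - y) * v (y + w) := by
      ext w; ring
    rw [h2, h1, ← integral_const_mul, ← integral_sub]
    · refine integral_congr_ae (Eventually.of_forall fun s => ?_)
      simp only; ring
    · exact hint1.mono_set (hsub y hy)
    · exact (hint.mono_set (hsub y hy)).const_mul y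
  have hA : ∀ y : ℝ, 0 ≤ y → ∫ s in Set.Ioi y, s * v s = A0 - ∫ s in (0 : ℝ)..y, s * v s := by
    intro y hy
    rw [hA0, ← intervalIntegral.integral_Ioi_sub_Ioi hint1 hy]; ring
  have hB : ∀ y : ℝ, 0 ≤ y → ∫ s in Set.Ioi y, v s = B0 - ∫ s in (0 : ℝ)..y, v s := by
    intro y hy
    rw [hB0, ← intervalIntegral.integral_Ioi_sub_Ioi hint hy]; ring
  -- a continuous representative on the whole line
  set vh : ℝ → ℝ := (Set.Ioi (0 : ℝ)).indicator v with hvh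
  have hvhi : Integrable vh := hint.integrable_indicator measurableSet_Ioi
  have hvhi1 : Integrable (fun s => s * vh s) := by
    refine (hint1.integrable_indicator measurableSet_Ioi).congr (Eventually.of_forall fun s => ?_)
    by_cases hs : s ∈ Set.Ioi (0 : ℝ) <;> simp [hvh, hs]
  set H : ℝ → ℝ := fun y => c ^ 2 * ((A0 - ∫ s in (0 : ℝ)..y, s * vh s) -
    y * (B0 - ∫ s in (0 : ℝ)..y, vh s)) with hH
  have hHc : Continuous H := by
    have h1 : Continuous fun y => ∫ s in (0 : ℝ)..y, s * vh s :=
      intervalIntegral.continuous_primitive (fun a b => hvhi1.intervalIntegrable) 0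
    have h2 : Continuous fun y => ∫ s in (0 : ℝ)..y, vh s :=
      intervalIntegral.continuous_primitive (fun a b => hvhi.intervalIntegrable) 0
    fun_prop
  have hvhv : ∀ y : ℝ, 0 ≤ y → (∫ s in (0 : ℝ)..y, s * vh s = ∫ s in (0 : ℝ)..y, s * v s) ∧
      (∫ s in (0 : ℝ)..y, vh s = ∫ s in (0 : ℝ)..y, v s) := by
    intro y hy
    rw [intervalIntegral.integral_of_le hy, intervalIntegral.integral_of_le hy,
      intervalIntegral.integral_of_le hy, intervalIntegral.integral_of_le hy]
    constructor <;>
    · refine setIntegral_congr_fun measurableSet_Ioc fun s hs => ?_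
      have : s ∈ Set.Ioi (0 : ℝ) := hs.1
      simp [hvh, this]
  have hHeq : ∀ y : ℝ, 0 ≤ y → H y = c ^ 2 * ∫ w in Set.Ioi (0 : ℝ), w * v (y + w) := by
    intro y hy
    rw [hH, htail y hy, hA y hy, hB y hy]
    simp only [(hvhv y hy).1, (hvhv y hy).2]
  have hvH : ∀ᵐ y, 0 < y → v y = H y := by
    filter_upwards [hae] with y hy h
    rw [hy h, hHeq y h.le]
  have hvHint : ∀ y : ℝ, 0 ≤ y → (∫ s in (0 : ℝ)..y, s * v s = ∫ s in (0 : ℝ)..y, s * H s) ∧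
      (∫ s in (0 : ℝ)..y, v s = ∫ s in (0 : ℝ)..y, H s) := by
    intro y hy
    constructor <;>
    · refine intervalIntegral.integral_congr_ae ?_
      filter_upwards [hvH] with s hs h
      rw [Set.uIoc_of_le hy] at h
      rw [hs h.1]
  -- `B` is the tail integral of `v`. Replacing `v` by the continuous `H` inside the integrals makes
  -- everything differentiable: `B' = -H` and `H' = -c² B` on the half-line, that is, `H'' = c² H`.
  set B : ℝ → ℝ := fun y => B0 - ∫ s in (0 : ℝ)..y, H s with hBdef
  set H2 : ℝ → ℝ := fun y => c ^ 2 * ((A0 - ∫ s in (0 : ℝ)..y, s * H s) - y * B y) with hH2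
  have hHH2 : ∀ y : ℝ, 0 ≤ y → H y = H2 y := by
    intro y hy
    rw [hHeq y hy, htail y hy, hA y hy, hB y hy, (hvHint y hy).1, (hvHint y hy).2]
  have hBd : ∀ y, HasDerivAt B (-H y) y := by
    intro y
    have := intervalIntegral.integral_hasDerivAt_right (hHc.intervalIntegrable 0 y)
      (hHc.stronglyMeasurableAtFilter _ _) hHc.continuousAt
    simpa [hBdef] using this.const_sub B0
  have hH2d : ∀ y, HasDerivAt H2 (-c ^ 2 * B y) y := by
    intro y
    have hsc : Continuous fun s => s * H s := continuous_id.mul hHc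
    have h1 := (intervalIntegral.integral_hasDerivAt_right (hsc.intervalIntegrable 0 y)
      (hsc.stronglyMeasurableAtFilter _ _) hsc.continuousAt).const_sub A0
    have h2 := (hasDerivAt_id y).mul (hBd y)
    have h3 := (h1.sub h2).const_mul (c ^ 2)
    refine h3.congr_deriv ?_
    simp only [id, one_mul]; ring
  -- boundedness
  have hBnn : ∀ y : ℝ, 0 ≤ y → 0 ≤ B y ∧ B y ≤ B0 := by
    intro y hy
    have : B y = ∫ s in Set.Ioi y, v s := by
      rw [hB y hy, (hvHint y hy).2]
    rw [this]
    exact ⟨setIntegral_nonneg measurableSet_Ioi fun s _ => hv0 s,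
      setIntegral_mono_set hint (Eventually.of_forall fun s => hv0 s)
        (LE.le.eventuallyLE (hsub y hy))⟩
  have hHnn : ∀ y : ℝ, 0 ≤ y → 0 ≤ H2 y ∧ H2 y ≤ c ^ 2 * A0 := by
    intro y hy
    rw [← hHH2 y hy]
    constructor
    · rw [hHeq y hy]
      exact mul_nonneg (sq_nonneg c) (setIntegral_nonneg measurableSet_Ioi fun w hw =>
        mul_nonneg (le_of_lt hw) (hv0 _))
    · rw [hHeq y hy, htail y hy]
      have h1 : ∫ s in Set.Ioi y, s * v s ≤ A0 :=
        setIntegral_mono_set hint1 ((ae_restrict_iff' measurableSet_Ioi).2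
          (Eventually.of_forall fun s hs => mul_nonneg (le_of_lt hs) (hv0 s)))
          (LE.le.eventuallyLE (hsub y hy))
      have h2 : 0 ≤ y * ∫ s in Set.Ioi y, v s :=
        mul_nonneg hy (setIntegral_nonneg measurableSet_Ioi fun s _ => hv0 s)
      exact mul_le_mul_of_nonneg_left (by linarith) (sq_nonneg c)
  -- first order equation
  have hconst : ∀ f : ℝ → ℝ, (∀ x, 0 ≤ x → HasDerivAt f 0 x) → ∀ x, 0 ≤ x → f x = f 0 := by
    intro f hf x hx
    refine constant_of_has_deriv_right_zero (a := 0) (b := x)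
      (fun z hz => (hf z hz.1).continuousAt.continuousWithinAt)
      (fun z hz => (hf z hz.1).hasDerivWithinAt) x ⟨hx, le_rfl⟩
  -- `H - cB` satisfies `W' = cW`, so it is a multiple of `e^{cx}`; boundedness then forces it to
  -- vanish, leaving `H' = -cH`.
  have hW : ∀ x, 0 ≤ x → (H2 x - c * B x) * Real.exp (-c * x) = H2 0 - c * B 0 := by
    intro x hx
    have := hconst (fun x => (H2 x - c * B x) * Real.exp (-c * x)) (fun x hx => ?_) x hx
    · simpa using this
    · have h1 : HasDerivAt (fun x => Real.exp (-c * x)) (Real.exp (-c * x) * -c) x := by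
        simpa using ((hasDerivAt_id x).const_mul (-c)).exp
      have h2 := (((hH2d x).sub ((hBd x).const_mul c))).mul h1
      refine h2.congr_deriv ?_
      rw [hHH2 x hx]
      simp only [Pi.sub_apply]
      ring
  have hW0 : H2 0 - c * B 0 = 0 := by
    have h1 : Tendsto (fun x => (c ^ 2 * A0 + c * B0) * Real.exp (-c * x)) atTop (𝓝 0) := by
      have : Tendsto (fun x => Real.exp (-c * x)) atTop (𝓝 0) := by
        refine Real.tendsto_exp_atBot.comp ?_
        exact tendsto_id.const_mul_atTop_of_neg (by linarith)
      simpa using this.const_mul (c ^ 2 * A0 + c * B0)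
    refine abs_eq_zero.1 (le_antisymm (ge_of_tendsto h1 ?_) (abs_nonneg _))
    filter_upwards [eventually_ge_atTop 0] with x hx
    rw [← hW x hx, abs_mul, abs_of_pos (Real.exp_pos _)]
    refine mul_le_mul_of_nonneg_right ?_ (Real.exp_pos _).le
    obtain ⟨h1, h2⟩ := hHnn x hx
    obtain ⟨h3, h4⟩ := hBnn x hx
    have h5 : 0 ≤ c * B x := by positivity
    have h6 : c * B x ≤ c * B0 := by gcongr
    rw [abs_le]; constructor <;> linarith
  have hWz : ∀ x, 0 ≤ x → c * B x = H2 x := by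
    intro x hx
    have h := hW x hx
    rw [hW0] at h
    rcases mul_eq_zero.1 h with h | h
    · linarith
    · exact absurd h (Real.exp_pos _).ne'
  have hfin : H2 y * Real.exp (c * y) = H2 0 := by
    have := hconst (fun x => H2 x * Real.exp (c * x)) (fun x hx => ?_) y hy
    · simpa using this
    · have h1 : HasDerivAt (fun x => Real.exp (c * x)) (Real.exp (c * x) * c) x := by
        simpa using ((hasDerivAt_id x).const_mul c).exp
      have h2 := (hH2d x).mul h1
      refine h2.congr_deriv ?_
      rw [← hWz x hx]; ring
  rw [← hHeq y hy, hHH2 y hy, neg_mul, Real.exp_neg, ← one_div, eq_div_iff (Real.exp_pos _).ne',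
    hfin, ← hHH2 0 le_rfl, hHeq 0 le_rfl, ← h0]

/-! ### Passing to the limit in the recurrence -/

/-- Extend the sum to all integers: `∑ m q^m = q/(1-q)²` with `q = e^{-a}`. This equals `1/(4
sinh²(a/2))`, and `sinh(a/2) ≥ a/2`. It supplies the summable bound in `j` for `limit_renewal`. -/
lemma sum_odd_mul_pow_le {a : ℝ} (ha : 0 < a) (N : ℕ) :
    ∑ r ∈ Finset.range N, (2 * r + 1 : ℝ) * Real.exp (-(a * (2 * r + 1))) ≤ 1 / a ^ 2 := by
  set q := Real.exp (-a) with hq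
  have hq0 : 0 < q := Real.exp_pos _
  have hq1 : q < 1 := by simp [hq, ha]
  have h1 : HasSum (fun n : ℕ => (n : ℝ) * q ^ n) (q / (1 - q) ^ 2) :=
    hasSum_coe_mul_geometric_of_norm_lt_one (by rw [Real.norm_eq_abs, abs_of_pos hq0]; exact hq1)
  have h2 : ∑ r ∈ Finset.range N, (2 * r + 1 : ℝ) * Real.exp (-(a * (2 * r + 1))) =
      ∑ n ∈ (Finset.range N).image (fun r : ℕ => 2 * r + 1), (n : ℝ) * q ^ n := by
    rw [Finset.sum_image (by intro a _ b _ h; dsimp only at h; omega)]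
    refine Finset.sum_congr rfl fun r _ => ?_
    rw [hq, ← Real.exp_nat_mul]
    push_cast
    congr 2
    ring
  rw [h2]
  refine (h1.summable.sum_le_tsum _ fun n _ => by positivity).trans ?_
  rw [h1.tsum_eq, div_le_div_iff₀ (by nlinarith) (by positivity), one_mul]
  have hs : a / 2 ≤ Real.sinh (a / 2) := Real.self_le_sinh_iff.2 (by positivity)
  rw [Real.sinh_eq] at hs
  set p := Real.exp (-(a / 2)) with hp
  have hp0 : 0 < p := Real.exp_pos _
  have hqp : q = p ^ 2 := by rw [hq, hp, ← Real.exp_nat_mul]; congr 1; push_cast; ring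
  have hpp : Real.exp (a / 2) * p = 1 := by rw [hp, ← Real.exp_add]; simp
  have h3 : a * p ≤ 1 - q := by
    rw [hqp]
    nlinarith
  rw [hqp] at h3 ⊢
  calc p ^ 2 * a ^ 2 = (a * p) ^ 2 := by ring
    _ ≤ _ := by gcongr

lemma integrableOn_mul_exp_neg {b : ℝ} (hb : 0 < b) :
    IntegrableOn (fun z : ℝ => z * Real.exp (-b * z)) (Set.Ioi 0) := by
  have := integrableOn_rpow_mul_exp_neg_mul_rpow (s := 1) (p := 1) (b := b) (by norm_num) (by norm_num) hb
  simpa using this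

lemma integrableOn_exp_neg {b : ℝ} (hb : 0 < b) :
    IntegrableOn (fun z : ℝ => Real.exp (-b * z)) (Set.Ioi 0) :=
  exp_neg_integrableOn_Ioi 0 hb

lemma tendsto_sqrt_natCast_atTop : Tendsto (fun n : ℕ => √(n : ℝ)) atTop atTop :=
  Real.tendsto_sqrt_atTop.comp tendsto_natCast_atTop_atTop

lemma eventually_le_of_div_sqrt {ns k : ℕ → ℕ} (hns : Tendsto ns atTop atTop) {y : ℝ}
    (hk : Tendsto (fun i => (k i : ℝ) / √(ns i)) atTop (𝓝 y)) : ∀ᶠ i in atTop, k i ≤ ns i := by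
  have ht := tendsto_sqrt_natCast_atTop.comp hns
  filter_upwards [hk.eventually_lt_const (lt_add_one y), ht.eventually_ge_atTop (y + 1),
    ht.eventually_gt_atTop 0] with i h1 h2 h3
  simp only [Function.comp] at h2 h3
  rw [div_lt_iff₀ h3] at h1
  have h4 : (k i : ℝ) ≤ ns i := by
    calc (k i : ℝ) ≤ (y + 1) * √(ns i) := h1.le
      _ ≤ √(ns i) * √(ns i) := by gcongr
      _ = ns i := Real.mul_self_sqrt (Nat.cast_nonneg _)
  exact_mod_cast h4

lemma tendsto_div_of_div_sqrt {ns k : ℕ → ℕ} (hns : Tendsto ns atTop atTop) {y : ℝ}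
    (hk : Tendsto (fun i => (k i : ℝ) / √(ns i)) atTop (𝓝 y)) :
    Tendsto (fun i => (k i : ℝ) / ns i) atTop (𝓝 0) := by
  have ht := tendsto_sqrt_natCast_atTop.comp hns
  have := hk.mul (tendsto_inv_atTop_zero.comp ht)
  rw [mul_zero] at this
  refine this.congr fun i => ?_
  simp only [Function.comp]
  rw [← div_eq_mul_inv, div_div, Real.mul_self_sqrt (Nat.cast_nonneg _)]

lemma hasSum_inv_two_mul_sq :
    HasSum (fun j : ℕ => 1 / (2 * ((j : ℝ) + 1) ^ 2)) (Real.pi ^ 2 / 12) := by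
  have h := (hasSum_nat_add_iff' 1).2 hasSum_zeta_two
  simp only [Finset.range_one, Finset.sum_singleton, Nat.cast_zero] at h
  have h2 := h.mul_left (1 / 2)
  have e : Real.pi ^ 2 / 12 = 1 / 2 * (Real.pi ^ 2 / 6 - 1 / 0 ^ 2) := by
    rw [zero_pow two_ne_zero, div_zero, sub_zero]; ring
  rw [e]
  refine h2.congr_fun fun j => ?_
  push_cast
  field_simp

/-- Passing to the limit in the recurrence for the number of partitions into odd parts. -/
lemma limit_renewal {ns : ℕ → ℕ} (hns : Tendsto ns atTop atTop) {v : ℝ → ℝ}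
    (hv : ∀ᵐ y, 0 < y → ∀ k : ℕ → ℕ, Tendsto (fun i => (k i : ℝ) / √(ns i)) atTop (𝓝 y) →
      Tendsto (fun i => oddRatio (ns i) (k i)) atTop (𝓝 (v y)))
    {k : ℕ → ℕ} {y L : ℝ} (hy : 0 ≤ y)
    (hk : Tendsto (fun i => (k i : ℝ) / √(ns i)) atTop (𝓝 y))
    (hL : Tendsto (fun i => oddRatio (ns i) (k i)) atTop (𝓝 L)) :
    L = Real.pi ^ 2 / 12 * ∫ w in Set.Ioi (0 : ℝ), w * v (y + w) := by
  have ht : Tendsto (fun i => √(ns i : ℝ)) atTop atTop := tendsto_sqrt_natCast_atTop.comp hns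
  set t : ℕ → ℝ := fun i => √(ns i : ℝ) with htdef
  set I := ∫ w in Set.Ioi (0 : ℝ), w * v (y + w) with hI
  set F : ℕ → ℕ → ℕ → ℝ := fun j i r =>
    (2 * r + 1 : ℝ) / t i * oddRatio (ns i) (k i + (j + 1) * (2 * r + 1)) with hF
  set S : ℕ → ℕ → ℝ := fun i j => (t i)⁻¹ * ∑ r ∈ Finset.range (ns i + 1), F j i r with hS
  have hF0 : ∀ j i r, ns i + 1 ≤ r → F j i r = 0 := by
    intro j i r hr
    simp only [hF]
    rw [oddRatio_eq_zero, mul_zero]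
    nlinarith [Nat.zero_le (k i), Nat.zero_le (j * (2 * r + 1))]
  -- the limit of each inner sum
  have hSj : ∀ j, Tendsto (fun i => S i j) atTop (𝓝 (1 / (2 * ((j : ℝ) + 1) ^ 2) * I)) := by
    intro j
    set b : ℝ := 2 * ((j : ℝ) + 1) with hb
    have hb0 : 0 < b := by positivity
    have hint : ∫ z in Set.Ioi (0 : ℝ), 2 * z * v (y + b * z) =
        1 / (2 * ((j : ℝ) + 1) ^ 2) * I := by
      have h1 := integral_comp_mul_left_Ioi (fun w => w * v (y + w)) 0 hb0
      rw [mul_zero, smul_eq_mul, ← hI] at h1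
      have h2 : (fun z => 2 * z * v (y + b * z)) =
          fun z => 2 / b * (b * z * v (y + b * z)) := by
        ext z; field_simp
      rw [h2, integral_const_mul, h1, hb]
      field_simp
    rw [← hint]
    -- The bound discards `k` and `j` and uses `2⌊zt⌋ + 1 ≥ (2z - 1)t` for `t ≥ 1` in the tail
    -- estimate.
    refine tendsto_riemannSum (ht.eventually_gt_atTop 0) (hF0 j)
      (bound := fun z => (2 * z + 1) * (3 * Real.exp (-((2 * z - 1) / 8)))) ?_ ?_ ?_
    · have h1 := ((integrableOn_mul_exp_neg (b := 1 / 4) (by norm_num)).const_mul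
        (6 * Real.exp (1 / 8))).add ((integrableOn_exp_neg (b := 1 / 4) (by norm_num)).const_mul
        (3 * Real.exp (1 / 8)))
      refine h1.congr (Eventually.of_forall fun z => ?_)
      have : Real.exp (-((2 * z - 1) / 8)) = Real.exp (1 / 8) * Real.exp (-(1 / 4) * z) := by
        rw [← Real.exp_add]; congr 1; ring
      simp only [Pi.add_apply, this]; ring
    · filter_upwards [ht.eventually_ge_atTop 1] with i hi z hz
      have hi0 : 0 < t i := by linarith
      have hfl : (⌊z * t i⌋₊ : ℝ) ≤ z * t i := Nat.floor_le (by positivity)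
      have hfl2 : z * t i < ⌊z * t i⌋₊ + 1 := Nat.lt_floor_add_one _
      rw [abs_of_nonneg (mul_nonneg (by positivity) (oddRatio_nonneg _ _))]
      refine mul_le_mul ?_ ?_ (oddRatio_nonneg _ _) (by positivity)
      · rw [div_le_iff₀ hi0]; nlinarith
      · have h1 : oddRatio (ns i) (k i + (j + 1) * (2 * ⌊z * t i⌋₊ + 1)) ≤
            oddRatio (ns i) (2 * ⌊z * t i⌋₊ + 1) := oddRatio_antitone _ (by nlinarith [Nat.zero_le (j * (2 * ⌊z * t i⌋₊ + 1))])
        refine (h1.trans (oddRatio_le_exp _ _)).trans ?_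
        refine mul_le_mul_of_nonneg_left (Real.exp_le_exp.2 (neg_le_neg ?_)) (by norm_num)
        change (2 * z - 1) / 8 ≤ ((2 * ⌊z * t i⌋₊ + 1 : ℕ) : ℝ) / (8 * t i)
        rw [div_le_div_iff₀ (by norm_num) (by positivity)]
        push_cast
        nlinarith
    -- The exceptional null set for `v` has a null preimage under the affine map `z ↦ y + bz`.
    · have hshift : ∀ᵐ z, 0 < y + b * z → ∀ k : ℕ → ℕ,
          Tendsto (fun i => (k i : ℝ) / √(ns i)) atTop (𝓝 (y + b * z)) →
          Tendsto (fun i => oddRatio (ns i) (k i)) atTop (𝓝 (v (y + b * z))) := by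
        have hq : Measure.QuasiMeasurePreserving (fun z : ℝ => y + b * z) volume volume :=
          (measurePreserving_add_left volume y).quasiMeasurePreserving.comp
            ⟨measurable_const_mul b, by
              rw [Real.map_volume_mul_left hb0.ne']
              exact Measure.smul_absolutelyContinuous⟩
        exact hq.ae hv
      filter_upwards [hshift] with z hz hz0
      have hz' := hz (by positivity)
      have hfl : Tendsto (fun i => (⌊z * t i⌋₊ : ℝ) / t i) atTop (𝓝 z) :=
        tendsto_natFloor_mul_div ht hz0.le
      have hodd : Tendsto (fun i => (2 * (⌊z * t i⌋₊ : ℝ) + 1) / t i) atTop (𝓝 (2 * z)) := by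
        have h1 := (hfl.const_mul 2).add (tendsto_inv_atTop_zero.comp ht)
        rw [add_zero] at h1
        refine h1.congr fun i => ?_
        simp only [Function.comp]; ring
      refine hodd.mul (hz' _ ?_)
      have h1 := hk.add (hodd.const_mul ((j : ℝ) + 1))
      have h2 : y + ((j : ℝ) + 1) * (2 * z) = y + b * z := by rw [hb]; ring
      rw [h2] at h1
      refine h1.congr fun i => ?_
      push_cast
      ring
  -- summing over `j`
  have hsum : Tendsto (fun i => ∑' j, S i j) atTop
      (𝓝 (∑' j : ℕ, 1 / (2 * ((j : ℝ) + 1) ^ 2) * I)) := by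
    -- The constant is `384 = 2 · 3 · 8²`: 3 and 8 come from `oddRatio_le_exp`, 2 from the
    -- normalisation of the summand.
    refine tendsto_tsum_of_dominated_convergence
      (bound := fun j : ℕ => 384 * (1 / (2 * ((j : ℝ) + 1) ^ 2)))
      (hasSum_inv_two_mul_sq.summable.mul_left _) hSj ?_
    filter_upwards [ht.eventually_gt_atTop 0] with i hi j
    have hj : 0 < ((j : ℝ) + 1) / (8 * t i) := by positivity
    rw [Real.norm_eq_abs, abs_of_nonneg (mul_nonneg (by positivity) (Finset.sum_nonneg fun r _ =>
      mul_nonneg (by positivity) (oddRatio_nonneg _ _)))]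
    calc S i j ≤ (t i)⁻¹ * ∑ r ∈ Finset.range (ns i + 1), 3 / t i * ((2 * r + 1 : ℝ) *
          Real.exp (-(((j : ℝ) + 1) / (8 * t i) * (2 * r + 1)))) := by
          simp only [hS, hF]
          refine mul_le_mul_of_nonneg_left (Finset.sum_le_sum fun r _ => ?_) (by positivity)
          have h1 : oddRatio (ns i) (k i + (j + 1) * (2 * r + 1)) ≤
            oddRatio (ns i) ((j + 1) * (2 * r + 1)) := oddRatio_antitone _ (by omega)
          calc (2 * r + 1 : ℝ) / t i * oddRatio (ns i) (k i + (j + 1) * (2 * r + 1))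
              ≤ (2 * r + 1 : ℝ) / t i * (3 * Real.exp (-(((j + 1) * (2 * r + 1) : ℕ) / (8 * t i)))) := by
                gcongr
                exact h1.trans (oddRatio_le_exp _ _)
            _ = _ := by
                push_cast
                rw [mul_div_right_comm]
                ring
      _ ≤ (t i)⁻¹ * (3 / t i * (1 / (((j : ℝ) + 1) / (8 * t i)) ^ 2)) := by
          rw [← Finset.mul_sum]
          gcongr
          exact sum_odd_mul_pow_le hj _
      _ = _ := by field_simp; norm_num
  rw [tsum_mul_right, hasSum_inv_two_mul_sq.tsum_eq] at hsum
  have hlhs : Tendsto (fun i => (1 - (k i : ℝ) / ns i) * oddRatio (ns i) (k i)) atTop (𝓝 L) := by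
    have := ((tendsto_div_of_div_sqrt hns hk).const_sub 1).mul hL
    simpa using this
  refine tendsto_nhds_unique hlhs (hsum.congr' ?_)
  filter_upwards [eventually_le_of_div_sqrt hns hk, hns.eventually_gt_atTop 0] with i hki hi
  have hn0 : (0 : ℝ) < ns i := by exact_mod_cast hi
  have htt : t i * t i = ns i := Real.mul_self_sqrt hn0.le
  have ht0 : 0 < t i := Real.sqrt_pos.2 hn0
  have hfin : ∑' j, S i j = ∑ j ∈ Finset.range (ns i), S i j := by
    refine tsum_eq_sum fun j hj => ?_
    have hj' : ns i ≤ j := by simpa using hj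
    simp only [hS, hF]
    rw [Finset.sum_eq_zero, mul_zero]
    intro r _
    rw [oddRatio_eq_zero, mul_zero]
    nlinarith [Nat.zero_le ((j + 1) * (2 * r)), Nat.zero_le (k i)]
  have h1 := sub_mul_oddRatio (ns i) (k i) hki
  have h2 : (1 - (k i : ℝ) / ns i) * oddRatio (ns i) (k i) =
      (t i * t i)⁻¹ * (((ns i : ℝ) - k i) * oddRatio (ns i) (k i)) := by
    rw [htt]; field_simp
  rw [hfin, h2, h1, Finset.mul_sum]
  refine Finset.sum_congr rfl fun j _ => ?_
  simp only [hS, hF]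
  rw [Finset.mul_sum, Finset.mul_sum]
  refine Finset.sum_congr rfl fun r _ => ?_
  rw [mul_inv]
  ring

/-! ### Compactness and the limit of the ratios -/

/-- The exponential rate `π / (2 √3)`. -/
noncomputable def rateConst : ℝ := Real.pi / (2 * √3)

lemma rateConst_pos : 0 < rateConst := by unfold rateConst; positivity

lemma rateConst_sq : rateConst ^ 2 = Real.pi ^ 2 / 12 := by
  unfold rateConst
  rw [div_pow, mul_pow, Real.sq_sqrt (by norm_num)]
  norm_num

/-- Helly selection for the ratios: along a subsequence they converge off a countable set of
scaled arguments. -/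
lemma exists_subseq_oddRatio (ns : ℕ → ℕ) (hns : Tendsto ns atTop atTop) (k : ℕ → ℕ) :
    ∃ ms : ℕ → ℕ, StrictMono ms ∧ (∃ L, Tendsto (fun i => oddRatio (ns (ms i)) (k (ms i))) atTop (𝓝 L)) ∧
      ∃ v : ℝ → ℝ, Antitone v ∧ (∀ y, 0 ≤ v y) ∧ ∀ᵐ y, 0 < y → ∀ k : ℕ → ℕ,
        Tendsto (fun i => (k i : ℝ) / √(ns (ms i))) atTop (𝓝 y) →
        Tendsto (fun i => oddRatio (ns (ms i)) (k i)) atTop (𝓝 (v y)) := by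
  -- One coordinate for each rational scale, and one more for the prescribed sequence `k`.
  have hcomp : IsCompact ((Set.univ.pi fun _ : ℚ => Set.Icc (0 : ℝ) 1) ×ˢ Set.Icc (0 : ℝ) 1) :=
    (isCompact_univ_pi fun _ => isCompact_Icc).prod isCompact_Icc
  obtain ⟨⟨g, L⟩, -, ms, hms, hlim⟩ := hcomp.tendsto_subseq
    (x := fun i => (fun r : ℚ => oddRatio (ns i) ⌊(r : ℝ) * √(ns i)⌋₊, oddRatio (ns i) (k i)))
    (fun i => ⟨fun r _ => ⟨oddRatio_nonneg _ _, oddRatio_le_one _ _⟩,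
      oddRatio_nonneg _ _, oddRatio_le_one _ _⟩)
  rw [Prod.tendsto_iff] at hlim
  obtain ⟨hg, hL⟩ := hlim
  have hg' : ∀ r : ℚ, Tendsto (fun i => oddRatio (ns (ms i)) ⌊(r : ℝ) * √(ns (ms i))⌋₊) atTop
      (𝓝 (g r)) := fun r => (tendsto_pi_nhds.1 hg) r
  have ht : Tendsto (fun i => √(ns (ms i) : ℝ)) atTop atTop :=
    tendsto_sqrt_natCast_atTop.comp (hns.comp hms.tendsto_atTop)
  set t : ℕ → ℝ := fun i => √(ns (ms i) : ℝ) with htdef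
  set v : ℝ → ℝ := fun y => limsup (fun i => oddRatio (ns (ms i)) ⌊y * t i⌋₊) atTop with hv
  have hub : ∀ y : ℝ, IsBoundedUnder (· ≤ ·) atTop
      (fun i => oddRatio (ns (ms i)) ⌊y * t i⌋₊) := fun y =>
    isBoundedUnder_of ⟨1, fun i => oddRatio_le_one _ _⟩
  have hlb : ∀ y : ℝ, IsBoundedUnder (· ≥ ·) atTop
      (fun i => oddRatio (ns (ms i)) ⌊y * t i⌋₊) := fun y =>
    isBoundedUnder_of ⟨0, fun i => oddRatio_nonneg _ _⟩
  have hvanti : Antitone v := by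
    intro a b hab
    refine limsup_le_limsup (Eventually.of_forall fun i => oddRatio_antitone _ ?_)
      (hlb b).isCoboundedUnder_le (hub a)
    refine Nat.floor_mono ?_
    have : 0 ≤ t i := Real.sqrt_nonneg _
    gcongr
  have hvq : ∀ r : ℚ, v r = g r := fun r => (hg' r).limsup_eq
  refine ⟨ms, hms, ⟨L, hL⟩, v, hvanti, ?_, ?_⟩
  · intro y
    obtain ⟨r, hr⟩ := exists_rat_gt y
    refine le_trans ?_ (hvanti hr.le)
    rw [hvq]
    exact ge_of_tendsto' (hg' r) fun i => oddRatio_nonneg _ _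
  · have hcount := hvanti.countable_not_continuousAt
    filter_upwards [hcount.ae_notMem volume] with y hy hy0 k hk
    have hc : ContinuousAt v y := by simpa using hy
    rw [tendsto_order]
    constructor
    · intro a ha
      have h1 : ∀ᶠ z in 𝓝[>] y, a < v z :=
        (hc.tendsto.mono_left nhdsWithin_le_nhds).eventually_const_lt ha
      obtain ⟨z, hz, hyz⟩ := (h1.and self_mem_nhdsWithin).exists
      obtain ⟨r, hyr, hrz⟩ := exists_rat_btwn (show y < z from hyz)
      have h2 : a < g r := by rw [← hvq]; exact hz.trans_le (hvanti hrz.le)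
      filter_upwards [(hg' r).eventually_const_lt h2, hk.eventually_lt_const hyr,
        ht.eventually_gt_atTop 0] with i hi1 hi2 hi3
      refine hi1.trans_le (oddRatio_antitone _ (Nat.le_floor ?_))
      rw [div_lt_iff₀ hi3] at hi2
      exact hi2.le
    · intro a ha
      have h1 : ∀ᶠ z in 𝓝[<] y, v z < a :=
        (hc.tendsto.mono_left nhdsWithin_le_nhds).eventually_lt_const ha
      obtain ⟨z, hz, hyz⟩ := (h1.and self_mem_nhdsWithin).exists
      obtain ⟨r, hzr, hry⟩ := exists_rat_btwn (show z < y from hyz)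
      have h2 : g r < a := by rw [← hvq]; exact (hvanti hzr.le).trans_lt hz
      filter_upwards [(hg' r).eventually_lt_const h2, hk.eventually_const_lt hry,
        ht.eventually_gt_atTop 0] with i hi1 hi2 hi3
      refine (oddRatio_antitone _ (Nat.floor_le_of_le ?_)).trans_lt hi1
      rw [lt_div_iff₀ hi3] at hi2
      exact hi2.le

/-- If `k n ~ y √n`, then the number of partitions of `n - k n` into odd parts is asymptotically
`e^{-cy}` times that of `n`, where `c = π / (2 √3)`. -/
theorem tendsto_oddRatio {k : ℕ → ℕ} {y : ℝ}
    (hk : Tendsto (fun n => (k n : ℝ) / √n) atTop (𝓝 y)) :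
    Tendsto (fun n => oddRatio n (k n)) atTop (𝓝 (Real.exp (-rateConst * y))) := by
  have hy : 0 ≤ y := ge_of_tendsto' hk fun n => by positivity
  refine tendsto_of_subseq_tendsto fun ns hns => ?_
  obtain ⟨ms, hms, ⟨L, hL⟩, v, hvanti, hv0, hv⟩ :=
    exists_subseq_oddRatio ns hns (fun i => k (ns i))
  have hns' : Tendsto (fun i => ns (ms i)) atTop atTop := hns.comp hms.tendsto_atTop
  have ht : Tendsto (fun i => √(ns (ms i) : ℝ)) atTop atTop :=
    tendsto_sqrt_natCast_atTop.comp hns'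
  refine ⟨ms, ?_⟩
  -- Used three times: at almost every `y` it gives the equation for `v`, with `k = 0` the
  -- normalisation, and with the given `k` it identifies `L`.
  have hren := @limit_renewal (fun i => ns (ms i)) hns' v hv
  have hvb : ∀ᵐ y, 0 < y → v y ≤ 3 * Real.exp (-(1 / 8) * y) := by
    filter_upwards [hv] with y hy hy0
    have hfl := tendsto_natFloor_mul_div ht hy0.le
    have h1 := hy hy0 (fun i => ⌊y * √(ns (ms i) : ℝ)⌋₊) hfl
    have h2 : Tendsto (fun i => 3 * Real.exp (-(1 / 8) *
        ((⌊y * √(ns (ms i) : ℝ)⌋₊ : ℝ) / √(ns (ms i) : ℝ)))) atTop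
        (𝓝 (3 * Real.exp (-(1 / 8) * y))) :=
      ((Real.continuous_exp.tendsto _).comp (hfl.const_mul _)).const_mul 3
    refine le_of_tendsto_of_tendsto' h1 h2 fun i => (oddRatio_le_exp _ _).trans_eq ?_
    congr 2
    rw [mul_comm 8, ← div_div]
    ring
  have hmeas : Measurable v := hvanti.measurable
  have hint : IntegrableOn v (Set.Ioi 0) := by
    refine Integrable.mono' ((integrableOn_exp_neg (b := 1 / 8) (by norm_num)).const_mul 3)
      hmeas.aestronglyMeasurable ((ae_restrict_iff' measurableSet_Ioi).2 ?_)
    filter_upwards [hvb] with z hz hz0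
    rw [Real.norm_eq_abs, abs_of_nonneg (hv0 z)]
    exact hz hz0
  have hint1 : IntegrableOn (fun s => s * v s) (Set.Ioi 0) := by
    refine Integrable.mono' ((integrableOn_mul_exp_neg (b := 1 / 8) (by norm_num)).const_mul 3)
      (measurable_id.mul hmeas).aestronglyMeasurable ((ae_restrict_iff' measurableSet_Ioi).2 ?_)
    filter_upwards [hvb] with z hz hz0
    have hz0' : 0 < z := hz0
    rw [Real.norm_eq_abs, abs_of_nonneg (mul_nonneg hz0'.le (hv0 z))]
    nlinarith [hz hz0]
  have hae : ∀ᵐ y, 0 < y → v y = rateConst ^ 2 * ∫ w in Set.Ioi (0 : ℝ), w * v (y + w) := by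
    filter_upwards [hv] with y hy hy0
    rw [rateConst_sq]
    have hfl := tendsto_natFloor_mul_div ht hy0.le
    exact hren hy0.le hfl (hy hy0 _ hfl)
  have h0 : 1 = rateConst ^ 2 * ∫ w in Set.Ioi (0 : ℝ), w * v (0 + w) := by
    rw [rateConst_sq]
    refine hren (k := fun _ => 0) le_rfl (by simp) ?_
    simp [oddRatio_zero]
  rw [← eq_exp_of_renewal rateConst_pos hv0 hint hint1 hae h0 hy, rateConst_sq,
    ← hren hy (hk.comp hns') hL]
  exact hL

/-! ### Hooks in terms of the multiset of parts -/

lemma List.countP_eq_card_filter_range {α : Type*} (w : List α) (d : α) (P : α → Prop)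
    [DecidablePred P] :
    w.countP P = ((Finset.range w.length).filter fun i => P (w.getD i d)).card := by
  induction w with
  | nil => simp
  | cons x w ih =>
    rw [List.countP_cons, ih, List.length_cons, Finset.range_add_one', Finset.filter_insert]
    have h1 : (Finset.filter (fun i => P ((x :: w).getD i d))
        (Finset.map ⟨fun i => i + 1, fun a b h => by simpa using h⟩ (Finset.range w.length))).card =
        ((Finset.range w.length).filter fun i => P (w.getD i d)).card := by
      rw [Finset.filter_map, Finset.card_map]
      rfl
    by_cases hx : P x
    · simp only [List.getD_cons_zero, hx, decide_true, if_true]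
      rw [Finset.card_insert_of_notMem, h1]
      simp
    · simp only [List.getD_cons_zero, hx, decide_false, if_false]
      rw [h1]; simp

lemma Nat.Partition.colLen_ferrers {n : ℕ} (p : n.Partition) (j : ℕ) :
    p.ferrers.colLen j = p.parts.countP (j < ·) := by
  set w := p.parts.sort (· ≥ ·) with hw
  have h1 : p.parts.countP (j < ·) = w.countP (j < ·) := by
    conv_lhs => rw [← Multiset.sort_eq p.parts (· ≥ ·)]
    rw [Multiset.coe_countP]
  rw [h1, List.countP_eq_card_filter_range w 0, ← Finset.card_range (p.ferrers.colLen j)]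
  congr 1
  ext i
  rw [Finset.mem_range, ← YoungDiagram.mem_iff_lt_colLen, Nat.Partition.ferrers,
    YoungDiagram.mem_ofRowLens, Finset.mem_filter, Finset.mem_range]
  constructor
  · rintro ⟨h, h'⟩
    exact ⟨h, by rw [List.getD_eq_getElem _ _ h]; exact h'⟩
  · rintro ⟨h, h'⟩
    exact ⟨h, by rw [List.getD_eq_getElem _ _ h] at h'; exact h'⟩

/-- The parts in the window `W`, and the copies of `m`, listed in this order, have the `l`-th one
(counted from `0`) among the copies of `m`. -/
def HookProp (W : Finset ℕ) (m l : ℕ) (s : Multiset ℕ) : Prop :=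
  s.countP (· ∈ W) ≤ l ∧ l < s.countP (· ∈ W) + s.count m

instance (W : Finset ℕ) (m l : ℕ) (s : Multiset ℕ) : Decidable (HookProp W m l s) :=
  inferInstanceAs (Decidable (_ ∧ _))

lemma Multiset.countP_lt_add (s : Multiset ℕ) (j a : ℕ) :
    s.countP (j < ·) = s.countP (j + a < ·) + s.countP (· ∈ Finset.Ico (j + 1) (j + 1 + a)) := by
  induction s using Multiset.induction_on with
  | empty => simp
  | cons x s ih =>
    simp only [Multiset.countP_cons, Finset.mem_Ico] at ih ⊢
    split_ifs <;> omega

lemma Multiset.countP_lt_succ (s : Multiset ℕ) (j : ℕ) :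
    s.countP (j < ·) = s.countP (j + 1 < ·) + s.count (j + 1) := by
  induction s using Multiset.induction_on with
  | empty => simp
  | cons x s ih =>
    simp only [Multiset.countP_cons, Multiset.count_cons] at ih ⊢
    split_ifs <;> omega

/-- Column lengths of the diagram are the counts `countP (j < ·)`. The right side says that row
`colLen j - (h - a)`, the one with leg `h - a - 1` in column `j`, has length exactly `j + a + 1`. -/
lemma hookProp_iff (s : Multiset ℕ) {j a h : ℕ} (ha : a < h) :
    HookProp (Finset.Ico (j + 1) (j + 1 + a)) (j + 1 + a) (h - a - 1) s ↔
      s.countP (j + a + 1 < ·) + (h - a) ≤ s.countP (j < ·) ∧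
        s.countP (j < ·) < s.countP (j + a < ·) + (h - a) := by
  have h1 := Multiset.countP_lt_add s j a
  have h2 := Multiset.countP_lt_succ s (j + a)
  rw [show j + a + 1 = j + 1 + a by ring] at h2 ⊢
  unfold HookProp
  omega

/-- A cell of hook number `h` is determined by its arm `a` and its column `j`: the leg is then `h -
a - 1`, which fixes the row. -/
lemma Nat.Partition.hookCount_eq {n : ℕ} (p : n.Partition) (h : ℕ) :
    p.hookCount h = ∑ a ∈ Finset.range h, ∑ j ∈ Finset.range n,
      if HookProp (Finset.Ico (j + 1) (j + 1 + a)) (j + 1 + a) (h - a - 1) p.parts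
        then 1 else 0 := by
  rw [← Finset.sum_product', Finset.sum_boole, Nat.cast_id, Nat.Partition.hookCount]
  set μ := p.ferrers with hμ
  have hK : ∀ j, p.parts.countP (j < ·) = μ.colLen j := fun j => (p.colLen_ferrers j).symm
  refine Finset.card_bij (fun c _ => (μ.armLength c, c.2)) ?_ ?_ ?_
  · rintro ⟨i, j⟩ hc
    rw [Finset.mem_filter, YoungDiagram.mem_cells] at hc
    obtain ⟨hc1, hc2⟩ := hc
    have hi := YoungDiagram.mem_iff_lt_colLen.1 hc1
    have hj := YoungDiagram.mem_iff_lt_rowLen.1 hc1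
    simp only [YoungDiagram.hookNumber, YoungDiagram.armLength, YoungDiagram.legLength] at hc2
    simp only [YoungDiagram.armLength, Finset.mem_filter, Finset.mem_product, Finset.mem_range]
    set a := μ.rowLen i - (j + 1) with ha
    have hah : a < h := by omega
    refine ⟨⟨hah, ?_⟩, ?_⟩
    · have hpos : 0 < p.parts.countP (j < ·) := by rw [hK]; omega
      obtain ⟨x, hx, hjx⟩ := Multiset.countP_pos.1 hpos
      have := Multiset.le_sum_of_mem hx
      rw [p.parts_sum] at this
      omega
    · rw [hookProp_iff _ hah, hK, hK, hK]
      have h1 : i < μ.colLen (j + a) := by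
        rw [← YoungDiagram.mem_iff_lt_colLen, YoungDiagram.mem_iff_lt_rowLen]; omega
      have h2 : ¬ i < μ.colLen (j + a + 1) := by
        rw [← YoungDiagram.mem_iff_lt_colLen, YoungDiagram.mem_iff_lt_rowLen]; omega
      omega
  · rintro ⟨i, j⟩ hc ⟨i', j'⟩ hc' heq
    rw [Finset.mem_filter, YoungDiagram.mem_cells] at hc hc'
    obtain ⟨hc1, hc2⟩ := hc
    obtain ⟨hc1', hc2'⟩ := hc'
    have hi := YoungDiagram.mem_iff_lt_colLen.1 hc1
    have hi' := YoungDiagram.mem_iff_lt_colLen.1 hc1'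
    obtain ⟨h1, h2⟩ := Prod.mk.inj heq
    simp only at h2
    subst h2
    simp only [YoungDiagram.hookNumber, YoungDiagram.legLength, h1] at hc2 hc2'
    congr 1
    omega
  · rintro ⟨a, j⟩ hb
    simp only [Finset.mem_filter, Finset.mem_product, Finset.mem_range] at hb
    obtain ⟨⟨hah, -⟩, hb⟩ := hb
    rw [hookProp_iff _ hah, hK, hK, hK] at hb
    set i := μ.colLen j - (h - a) with hi
    have h1 : (i, j + a) ∈ μ := by rw [YoungDiagram.mem_iff_lt_colLen]; omega
    have h2 : (i, j + a + 1) ∉ μ := by rw [YoungDiagram.mem_iff_lt_colLen]; omega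
    have h3 : (i, j) ∈ μ := by rw [YoungDiagram.mem_iff_lt_colLen]; omega
    rw [YoungDiagram.mem_iff_lt_rowLen] at h1 h2
    have harm : μ.armLength (i, j) = a := by simp only [YoungDiagram.armLength]; omega
    refine ⟨(i, j), ?_, by rw [harm]⟩
    rw [Finset.mem_filter, YoungDiagram.mem_cells]
    refine ⟨h3, ?_⟩
    simp only [YoungDiagram.hookNumber, harm, YoungDiagram.legLength]
    omega

/-! ### From partitions to counts; Euler's theorem -/

lemma card_filter_parts (P : Multiset ℕ → Prop) [DecidablePred P] (n : ℕ) :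
    ((Finset.univ : Finset n.Partition).filter fun p => P p.parts).card = pcount P n 0 := by
  have hinj : Function.Injective fun p : n.Partition => p.parts :=
    fun p p' h => Nat.Partition.ext h
  rw [pcount, ← Finset.card_image_of_injective _ hinj, ← Set.ncard_coe_finset]
  congr 1
  ext s
  simp only [Finset.coe_image, Finset.coe_filter, Finset.mem_univ, true_and, Set.mem_image,
    Set.mem_ofPred_eq, partsSet, add_zero]
  constructor
  · rintro ⟨p, hp, rfl⟩
    exact ⟨fun i hi => p.parts_pos hi, p.parts_sum, hp⟩
  · rintro ⟨h1, h2, h3⟩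
    exact ⟨⟨s, fun {i} hi => h1 i hi, h2⟩, h3, rfl⟩

lemma sum_hookCount (P : Multiset ℕ → Prop) [DecidablePred P] (n h : ℕ) :
    ∑ p ∈ (Finset.univ : Finset n.Partition).filter (fun p => P p.parts), p.hookCount h =
      ∑ a ∈ Finset.range h, ∑ j ∈ Finset.range n, pcount
        (fun s => P s ∧ HookProp (Finset.Ico (j + 1) (j + 1 + a)) (j + 1 + a) (h - a - 1) s) n 0 := by
  simp_rw [Nat.Partition.hookCount_eq]
  rw [Finset.sum_comm]
  refine Finset.sum_congr rfl fun a _ => ?_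
  rw [Finset.sum_comm]
  refine Finset.sum_congr rfl fun j _ => ?_
  rw [← card_filter_parts, Finset.sum_boole, Nat.cast_id, Finset.filter_filter]

lemma odds_eq_filter (n : ℕ) [DecidablePred AllOdd] :
    Nat.Partition.odds n = Finset.univ.filter fun p => AllOdd p.parts := by
  ext p
  rw [Nat.Partition.odds, Nat.Partition.restricted, Finset.mem_filter, Finset.mem_filter]
  simp only [AllOdd, Nat.not_even_iff_odd]

lemma card_odds (n : ℕ) : (Nat.Partition.odds n).card = pcount AllOdd n 0 := by
  classical
  rw [odds_eq_filter]
  exact card_filter_parts AllOdd n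

lemma pcount_eq_pcount_sub (P : Multiset ℕ → Prop) {n k : ℕ} (h : k ≤ n) :
    pcount P n k = pcount P (n - k) 0 := by
  unfold pcount
  congr 1
  ext s
  simp only [partsSet, Set.mem_ofPred_eq]
  constructor <;> rintro ⟨h1, h2, h3⟩ <;> exact ⟨h1, by omega, h3⟩

/-- Euler's theorem. -/
lemma pcount_nodup_eq (n k : ℕ) : pcount Multiset.Nodup n k = pcount AllOdd n k := by
  rcases lt_or_ge n k with h | h
  · rw [pcount_eq_zero _ h, pcount_eq_zero _ h]
  rw [pcount_eq_pcount_sub _ h, pcount_eq_pcount_sub _ h, ← card_odds,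
    Nat.Partition.card_odds_eq_card_distincts]
  exact (card_filter_parts Multiset.Nodup _).symm

/-! ### Recursions for enlarging the window by one integer -/

lemma countP_insert_of_notMem {i : ℕ} {s : Multiset ℕ} (hi : i ∉ s) (W : Finset ℕ) :
    s.countP (· ∈ insert i W) = s.countP (· ∈ W) := by
  refine Multiset.countP_congr rfl fun x hx => ?_
  have : x ≠ i := fun h => hi (h ▸ hx)
  simp [this]

lemma hookProp_insert_of_notMem {i : ℕ} {s : Multiset ℕ} (hi : i ∉ s) (W : Finset ℕ) (m l : ℕ) :
    HookProp (insert i W) m l s ↔ HookProp W m l s := by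
  rw [HookProp, HookProp, countP_insert_of_notMem hi]

lemma hookProp_cons_of_notMem {i m : ℕ} {W : Finset ℕ} (hiW : i ∉ W) (him : i ≠ m) (l : ℕ)
    (s : Multiset ℕ) : HookProp W m l (i ::ₘ s) ↔ HookProp W m l s := by
  rw [HookProp, HookProp, Multiset.countP_cons_of_neg _ hiW, Multiset.count_cons_of_ne him.symm]

lemma hookProp_insert_cons_succ {i m : ℕ} (W : Finset ℕ) (him : i ≠ m) (l : ℕ)
    (s : Multiset ℕ) : HookProp (insert i W) m (l + 1) (i ::ₘ s) ↔ HookProp (insert i W) m l s := by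
  have h : (i ::ₘ s).countP (· ∈ insert i W) = s.countP (· ∈ insert i W) + 1 :=
    Multiset.countP_cons_of_pos _ (Finset.mem_insert_self i W)
  rw [HookProp, HookProp, h, Multiset.count_cons_of_ne him.symm]
  omega

lemma not_hookProp_insert_cons_zero {i m : ℕ} (W : Finset ℕ) (s : Multiset ℕ) :
    ¬ HookProp (insert i W) m 0 (i ::ₘ s) := by
  rw [HookProp, Multiset.countP_cons_of_pos _ (Finset.mem_insert_self i W)]
  omega

/-- The number of partitions of `n - k` into odd parts with the property `HookProp W m l`. -/
noncomputable def oddHook (W : Finset ℕ) (m l n k : ℕ) : ℕ :=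
  pcount (fun s => AllOdd s ∧ HookProp W m l s) n k

/-- The number of partitions of `n - k` into distinct parts with the property `HookProp W m l`. -/
noncomputable def distinctHook (W : Finset ℕ) (m l n k : ℕ) : ℕ :=
  pcount (fun s => s.Nodup ∧ HookProp W m l s) n k

/-- The number of partitions of `n - k` into distinct parts different from `i` with the property
`HookProp W m l`. -/
noncomputable def distinctHookAvoid (i : ℕ) (W : Finset ℕ) (m l n k : ℕ) : ℕ :=
  pcount (fun s => (s.Nodup ∧ HookProp W m l s) ∧ i ∉ s) n k

lemma oddHook_insert_even {i : ℕ} (hi : ¬ Odd i) (W : Finset ℕ) (m l n k : ℕ) :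
    oddHook (insert i W) m l n k = oddHook W m l n k :=
  pcount_congr _ _ fun _ _ => and_congr_right fun hs =>
    hookProp_insert_of_notMem (fun h => hi (hs i h)) W m l

/-- An `i` outside the window and different from `m` does not affect the hook condition, so a copy
of it can be removed freely. -/
lemma oddHook_split {i m : ℕ} (hi : Odd i) {W : Finset ℕ} (hiW : i ∉ W) (him : i ≠ m)
    (l n k : ℕ) :
    pcount (fun s => (AllOdd s ∧ HookProp W m l s) ∧ i ∉ s) n k + oddHook W m l n (k + i) =
      oddHook W m l n k := by
  rw [oddHook, oddHook, pcount_split (fun s => AllOdd s ∧ HookProp W m l s) (fun s => i ∈ s) n k,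
    pcount_mem (fun s => AllOdd s ∧ HookProp W m l s) hi.pos, add_comm]
  congr 1
  refine pcount_congr _ _ fun s _ => ?_
  rw [allOdd_cons hi, hookProp_cons_of_notMem hiW him]

lemma oddHook_insert_avoid (i m l n k : ℕ) (W : Finset ℕ) :
    pcount (fun s => (AllOdd s ∧ HookProp (insert i W) m l s) ∧ i ∉ s) n k =
      pcount (fun s => (AllOdd s ∧ HookProp W m l s) ∧ i ∉ s) n k :=
  pcount_congr _ _ fun _ _ => and_congr_left fun h => and_congr_right fun _ =>
    hookProp_insert_of_notMem h W m l

lemma oddHook_insert_zero {i m : ℕ} (hi : Odd i) {W : Finset ℕ} (hiW : i ∉ W) (him : i ≠ m)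
    (n k : ℕ) :
    oddHook (insert i W) m 0 n k + oddHook W m 0 n (k + i) = oddHook W m 0 n k := by
  rw [← oddHook_split hi hiW him 0 n k, ← oddHook_insert_avoid, oddHook,
    pcount_split (fun s => AllOdd s ∧ HookProp (insert i W) m 0 s) (fun s => i ∈ s) n k,
    pcount_mem (fun s => AllOdd s ∧ HookProp (insert i W) m 0 s) hi.pos]
  have h : pcount (fun s => AllOdd (i ::ₘ s) ∧ HookProp (insert i W) m 0 (i ::ₘ s)) n (k + i) =
      0 := by
    unfold pcount
    convert Set.ncard_empty (Multiset ℕ)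
    ext s
    simp [partsSet, not_hookProp_insert_cons_zero]
  rw [h, zero_add]

/-- Split by whether `i` occurs. If not, the two windows agree. If so, removing one copy lowers the
index by one but keeps `i` in the window, since odd parts may repeat. -/
lemma oddHook_insert_succ {i m : ℕ} (hi : Odd i) {W : Finset ℕ} (hiW : i ∉ W) (him : i ≠ m)
    (l n k : ℕ) :
    oddHook (insert i W) m (l + 1) n k + oddHook W m (l + 1) n (k + i) =
      oddHook W m (l + 1) n k + oddHook (insert i W) m l n (k + i) := by
  rw [← oddHook_split hi hiW him (l + 1) n k, ← oddHook_insert_avoid, oddHook,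
    pcount_split (fun s => AllOdd s ∧ HookProp (insert i W) m (l + 1) s) (fun s => i ∈ s) n k,
    pcount_mem (fun s => AllOdd s ∧ HookProp (insert i W) m (l + 1) s) hi.pos]
  have h : pcount (fun s => AllOdd (i ::ₘ s) ∧ HookProp (insert i W) m (l + 1) (i ::ₘ s)) n
      (k + i) = oddHook (insert i W) m l n (k + i) := by
    refine pcount_congr _ _ fun s _ => ?_
    rw [allOdd_cons hi, hookProp_insert_cons_succ W him]
  rw [h]
  ring

lemma hookProp_empty (m l : ℕ) (s : Multiset ℕ) : HookProp ∅ m l s ↔ l + 1 ≤ s.count m := by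
  simp [HookProp]

lemma oddHook_empty {m : ℕ} (hm : Odd m) (l n k : ℕ) :
    oddHook ∅ m l n k = pcount AllOdd n (k + (l + 1) * m) := by
  rw [← pcount_allOdd_le_count hm]
  exact pcount_congr _ _ fun s _ => and_congr_right fun _ => hookProp_empty m l s

lemma mem_of_hookProp {W : Finset ℕ} {m l : ℕ} {s : Multiset ℕ} (h : HookProp W m l s) : m ∈ s :=
  Multiset.count_pos.1 (by have := h.1; have := h.2; omega)

lemma oddHook_of_even {m : ℕ} (hm : ¬ Odd m) (W : Finset ℕ) (l n k : ℕ) :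
    oddHook W m l n k = 0 := by
  unfold oddHook pcount
  convert Set.ncard_empty (Multiset ℕ)
  ext s
  simp only [partsSet, Set.mem_ofPred_eq, Set.mem_empty_iff_false, iff_false]
  rintro ⟨-, -, h1, h2⟩
  exact hm (h1 m (mem_of_hookProp h2))

lemma oddHook_le {m : ℕ} (hm : 0 < m) (W : Finset ℕ) (l n k : ℕ) :
    oddHook W m l n k ≤ pcount AllOdd n (k + m) := by
  by_cases h : Odd m
  · calc oddHook W m l n k ≤ pcount (fun s => AllOdd s ∧ m ∈ s) n k :=
          pcount_mono _ _ fun s hs => ⟨hs.1, mem_of_hookProp hs.2⟩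
      _ = pcount (fun s => AllOdd (m ::ₘ s)) n (k + m) := pcount_mem AllOdd hm n k
      _ = _ := pcount_congr _ _ fun s _ => allOdd_cons h s
  · rw [oddHook_of_even h]; exact Nat.zero_le _

lemma distinctHook_le {m : ℕ} (hm : 0 < m) (W : Finset ℕ) (l n k : ℕ) :
    distinctHook W m l n k ≤ pcount AllOdd n (k + m) := by
  rw [← pcount_nodup_eq]
  calc distinctHook W m l n k ≤ pcount (fun s => s.Nodup ∧ m ∈ s) n k :=
        pcount_mono _ _ fun s hs => ⟨hs.1, mem_of_hookProp hs.2⟩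
    _ = pcount (fun s => (m ::ₘ s).Nodup) n (k + m) := pcount_mem Multiset.Nodup hm n k
    _ ≤ _ := pcount_mono _ _ fun s hs => (Multiset.nodup_cons.1 hs).2

lemma pcount_avoid_add {P : Multiset ℕ → Prop} {i : ℕ} (hi : 0 < i)
    (hP : ∀ s, P (i ::ₘ s) ↔ P s ∧ i ∉ s) (n k : ℕ) :
    pcount (fun s => P s ∧ i ∉ s) n k + pcount (fun s => P s ∧ i ∉ s) n (k + i) =
      pcount P n k := by
  rw [pcount_split P (fun s => i ∈ s) n k, pcount_mem P hi, add_comm]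
  congr 1
  exact pcount_congr _ _ fun s _ => (hP s).symm

/-- Partitions containing `i` become, on removing it, partitions of smaller size that avoid `i`.
This determines the avoiding count as an alternating sum of shifts. -/
lemma distinctHookAvoid_add {i m : ℕ} (hi : 0 < i) {W : Finset ℕ} (hiW : i ∉ W) (him : i ≠ m)
    (l n k : ℕ) :
    distinctHookAvoid i W m l n k + distinctHookAvoid i W m l n (k + i) =
      distinctHook W m l n k := by
  refine pcount_avoid_add hi (fun s => ?_) n k
  rw [Multiset.nodup_cons, hookProp_cons_of_notMem hiW him]
  tauto

lemma distinctHookAvoid_le (i : ℕ) (W : Finset ℕ) (m l n k : ℕ) :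
    distinctHookAvoid i W m l n k ≤ pcount AllOdd n k := by
  rw [← pcount_nodup_eq]
  exact pcount_mono _ _ fun s hs => hs.1.1

lemma distinctHook_insert_zero {i m : ℕ} (hi : 0 < i) (W : Finset ℕ) (n k : ℕ) :
    distinctHook (insert i W) m 0 n k = distinctHookAvoid i W m 0 n k := by
  rw [distinctHook,
    pcount_split (fun s => s.Nodup ∧ HookProp (insert i W) m 0 s) (fun s => i ∈ s) n k,
    pcount_mem (fun s => s.Nodup ∧ HookProp (insert i W) m 0 s) hi]
  have h : pcount (fun s => (i ::ₘ s).Nodup ∧ HookProp (insert i W) m 0 (i ::ₘ s)) n (k + i) =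
      0 := by
    unfold pcount
    convert Set.ncard_empty (Multiset ℕ)
    ext s
    simp [partsSet, not_hookProp_insert_cons_zero]
  rw [h, zero_add]
  exact pcount_congr _ _ fun _ _ => and_congr_left fun h => and_congr_right fun _ =>
    hookProp_insert_of_notMem h W m 0

/-- Here removing `i` leaves a partition avoiding `i`, so both terms involve only the old window. -/
lemma distinctHook_insert_succ {i m : ℕ} (hi : 0 < i) (W : Finset ℕ) (him : i ≠ m)
    (l n k : ℕ) :
    distinctHook (insert i W) m (l + 1) n k =
      distinctHookAvoid i W m (l + 1) n k + distinctHookAvoid i W m l n (k + i) := by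
  rw [distinctHook,
    pcount_split (fun s => s.Nodup ∧ HookProp (insert i W) m (l + 1) s) (fun s => i ∈ s) n k,
    pcount_mem (fun s => s.Nodup ∧ HookProp (insert i W) m (l + 1) s) hi, add_comm]
  congr 1
  · exact pcount_congr _ _ fun _ _ => and_congr_left fun h => and_congr_right fun _ =>
      hookProp_insert_of_notMem h W m (l + 1)
  · refine pcount_congr _ _ fun s _ => ?_
    rw [Multiset.nodup_cons, hookProp_insert_cons_succ W him]
    constructor
    · rintro ⟨⟨h1, h2⟩, h3⟩
      exact ⟨⟨h2, (hookProp_insert_of_notMem h1 W m l).1 h3⟩, h1⟩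
    · rintro ⟨⟨h1, h2⟩, h3⟩
      exact ⟨⟨h3, h1⟩, (hookProp_insert_of_notMem h3 W m l).2 h2⟩

lemma distinctHook_empty_zero {m : ℕ} (hm : 0 < m) (n k : ℕ) :
    distinctHook ∅ m 0 n k = pcount (fun s => s.Nodup ∧ m ∉ s) n (k + m) := by
  have h : distinctHook ∅ m 0 n k = pcount (fun s => s.Nodup ∧ m ∈ s) n k :=
    pcount_congr _ _ fun s _ => and_congr_right fun _ => by
      rw [hookProp_empty, zero_add, Multiset.one_le_count_iff_mem]
  rw [h, pcount_mem Multiset.Nodup hm]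
  exact pcount_congr _ _ fun s _ => by rw [Multiset.nodup_cons, and_comm]

lemma distinctHook_empty_succ (m l n k : ℕ) : distinctHook ∅ m (l + 1) n k = 0 := by
  unfold distinctHook pcount
  convert Set.ncard_empty (Multiset ℕ)
  ext s
  simp only [partsSet, Set.mem_ofPred_eq, Set.mem_empty_iff_false, iff_false]
  rintro ⟨-, -, h1, h2⟩
  rw [hookProp_empty] at h2
  have := Multiset.nodup_iff_count_le_one.1 h1 m
  omega

/-! ### Limits stable under shifts, and the limiting hook proportions -/

/-- `X n (k n)` is asymptotically `L e^{-cz}` times the number of partitions of `n` into odd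
parts, whenever `k n ~ z √n`. -/
def HasShiftLim (X : ℕ → ℕ → ℕ) (L : ℝ) : Prop :=
  ∀ (k : ℕ → ℕ) (z : ℝ), Tendsto (fun n => (k n : ℝ) / √n) atTop (𝓝 z) →
    Tendsto (fun n => (X n (k n) : ℝ) / pcount AllOdd n 0) atTop
      (𝓝 (L * Real.exp (-rateConst * z)))

lemma hasShiftLim_pcount : HasShiftLim (pcount AllOdd) 1 := by
  intro k z hk
  rw [one_mul]
  exact tendsto_oddRatio hk

lemma hasShiftLim_zero : HasShiftLim (fun _ _ => 0) 0 := by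
  intro k z hk
  simp

lemma HasShiftLim.congr {X Y : ℕ → ℕ → ℕ} {L : ℝ} (h : HasShiftLim X L)
    (hXY : ∀ n k, Y n k = X n k) : HasShiftLim Y L := by
  intro k z hk
  simpa only [hXY] using h k z hk

lemma HasShiftLim.shift {X : ℕ → ℕ → ℕ} {L : ℝ} (h : HasShiftLim X L) {i : ℕ → ℕ} {y : ℝ}
    (hi : Tendsto (fun n => (i n : ℝ) / √n) atTop (𝓝 y)) :
    HasShiftLim (fun n k => X n (k + i n)) (L * Real.exp (-rateConst * y)) := by
  intro k z hk
  have h1 := h (fun n => k n + i n) (z + y) (by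
    refine (hk.add hi).congr fun n => ?_
    push_cast; ring)
  rw [mul_assoc, ← Real.exp_add]
  convert h1 using 3
  ring_nf

lemma HasShiftLim.add {X Y : ℕ → ℕ → ℕ} {L M : ℝ} (hX : HasShiftLim X L) (hY : HasShiftLim Y M) :
    HasShiftLim (fun n k => X n k + Y n k) (L + M) := by
  intro k z hk
  rw [add_mul]
  refine ((hX k z hk).add (hY k z hk)).congr fun n => ?_
  push_cast; ring

lemma HasShiftLim.of_add_eq {X Y Z : ℕ → ℕ → ℕ} {L M : ℝ} (hX : HasShiftLim X L)
    (hY : HasShiftLim Y M) (h : ∀ n k, Z n k + Y n k = X n k) : HasShiftLim Z (L - M) := by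
  intro k z hk
  rw [sub_mul]
  refine ((hX k z hk).sub (hY k z hk)).congr fun n => ?_
  rw [← h]
  push_cast; ring

lemma eq_alternating_sum {B X : ℕ → ℝ} {i : ℕ} (h : ∀ k, B k + B (k + i) = X k) (N k : ℕ) :
    B k = ∑ l ∈ Finset.range N, (-1) ^ l * X (k + l * i) + (-1) ^ N * B (k + N * i) := by
  induction N with
  | zero => simp
  | succ N ih =>
    rw [Finset.sum_range_succ, ih, ← h (k + N * i), pow_succ]
    rw [show k + (N + 1) * i = k + N * i + i by ring]
    ring

/-- Solving for `B` gives `∑ (-1)^l X(k + l i)`, finite because `i` is eventually positive. Termwise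
the limit is a geometric series of ratio `-e^{-cy}`, and the tail bound justifies the interchange.
-/
lemma HasShiftLim.of_add_shift_eq {X B : ℕ → ℕ → ℕ} {L : ℝ} (hX : HasShiftLim X L) {i : ℕ → ℕ}
    {y : ℝ} (hy : 0 < y) (hi : Tendsto (fun n => (i n : ℝ) / √n) atTop (𝓝 y))
    (hB : ∀ n k, B n k ≤ pcount AllOdd n k) (h : ∀ n k, B n k + B n (k + i n) = X n k) :
    HasShiftLim B (L / (1 + Real.exp (-rateConst * y))) := by
  intro k z hk
  set x := Real.exp (-rateConst * y) with hx
  have hx0 : 0 < x := Real.exp_pos _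
  have hx1 : x < 1 := by
    rw [hx, Real.exp_lt_one_iff]
    have := rateConst_pos
    nlinarith
  set Q : ℕ → ℝ := fun n => (pcount AllOdd n 0 : ℝ) with hQ
  have hQ0 : ∀ n, 0 < Q n := fun n => Nat.cast_pos.2 (pcount_allOdd_pos n)
  have hterm : ∀ l : ℕ, Tendsto (fun n => (-1 : ℝ) ^ l * ((X n (k n + l * i n) : ℝ) / Q n)) atTop
      (𝓝 (L * Real.exp (-rateConst * z) * (-x) ^ l)) := by
    intro l
    have h1 := (hX (fun n => k n + l * i n) (z + l * y) (by
      refine (hk.add (hi.const_mul (l : ℝ))).congr fun n => ?_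
      push_cast; ring)).const_mul ((-1 : ℝ) ^ l)
    convert h1 using 2
    rw [neg_pow x, hx, ← Real.exp_nat_mul, mul_add, Real.exp_add]
    ring_nf
  have hgeo : HasSum (fun l : ℕ => (-x) ^ l) (1 - -x)⁻¹ :=
    hasSum_geometric_of_norm_lt_one (by rw [Real.norm_eq_abs, abs_neg, abs_of_pos hx0]; exact hx1)
  have hsum : Tendsto (fun n => ∑' l : ℕ, (-1 : ℝ) ^ l * ((X n (k n + l * i n) : ℝ) / Q n)) atTop
      (𝓝 (∑' l : ℕ, L * Real.exp (-rateConst * z) * (-x) ^ l)) := by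
    -- Eventually `i n ≥ (y/2)√n`; with the rate `1/8` of the tail bound this gives ratio
    -- `e^{-y/16}`. The 6 is 2 from `X ≤ 2 · pcount` times 3.
    have hr1 : Real.exp (-(y / 16)) < 1 := by rw [Real.exp_lt_one_iff]; linarith
    refine tendsto_tsum_of_dominated_convergence
      (bound := fun l : ℕ => 6 * Real.exp (-(y / 16)) ^ l)
      ((summable_geometric_of_lt_one (Real.exp_pos _).le hr1).mul_left 6) hterm ?_
    filter_upwards [hi.eventually_const_lt (show y / 2 < y by linarith)] with n hn l
    rw [norm_mul, norm_pow, norm_neg, norm_one, one_pow, one_mul, Real.norm_eq_abs,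
      abs_of_nonneg (by positivity)]
    have h1 : (X n (k n + l * i n) : ℝ) / Q n ≤ 2 * oddRatio n (l * i n) := by
      have h2 : X n (k n + l * i n) ≤ 2 * pcount AllOdd n (l * i n) := by
        rw [← h, two_mul]
        exact add_le_add ((hB _ _).trans (pcount_allOdd_antitone n (by omega)))
          ((hB _ _).trans (pcount_allOdd_antitone n (by omega)))
      have h3 : (X n (k n + l * i n) : ℝ) ≤ 2 * pcount AllOdd n (l * i n) := by exact_mod_cast h2
      rw [oddRatio, ← mul_div_assoc]
      exact div_le_div_of_nonneg_right h3 (hQ0 n).le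
    have h4 := oddRatio_le_exp n (l * i n)
    have h5 : Real.exp (-(((l * i n : ℕ) : ℝ) / (8 * √n))) ≤ Real.exp (-(y / 16)) ^ l := by
      rw [← Real.exp_nat_mul]
      refine Real.exp_le_exp.2 ?_
      have h6 : ((l * i n : ℕ) : ℝ) / (8 * √n) = l * ((i n : ℝ) / √n) / 8 := by
        push_cast; rw [mul_comm (8 : ℝ), ← div_div]; ring
      rw [h6]
      have : (l : ℝ) * (y / 2) ≤ l * ((i n : ℝ) / √n) := by gcongr
      linarith
    linarith
  rw [tsum_mul_left, hgeo.tsum_eq] at hsum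
  have hlim : L / (1 + x) * Real.exp (-rateConst * z) =
      L * Real.exp (-rateConst * z) * (1 - -x)⁻¹ := by
    rw [sub_neg_eq_add]; ring
  rw [hlim]
  refine hsum.congr' ?_
  filter_upwards [hi.eventually_const_lt hy] with n hn
  have hin : 0 < i n := by
    rcases Nat.eq_zero_or_pos (i n) with h0 | h0
    · simp [h0] at hn
    · exact h0
  have hbig : ∀ l, n + 1 ≤ l → n < k n + l * i n := by
    intro l hl
    nlinarith [Nat.zero_le (k n)]
  have hXB : ∀ k, (B n k : ℝ) + B n (k + i n) = X n k := fun k => by exact_mod_cast h n k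
  rw [tsum_eq_sum (s := Finset.range (n + 1))]
  · rw [eq_alternating_sum hXB (n + 1) (k n)]
    have h0 : B n (k n + (n + 1) * i n) = 0 := by
      have := hB n (k n + (n + 1) * i n)
      rw [pcount_eq_zero _ (hbig _ le_rfl)] at this
      omega
    rw [h0, Nat.cast_zero, mul_zero, add_zero, Finset.sum_div]
    exact Finset.sum_congr rfl fun l _ => by rw [mul_div_assoc]
  · intro l hl
    have hl' : n + 1 ≤ l := by simpa using hl
    have h0 : X n (k n + l * i n) = 0 := by
      have h1 := hB n (k n + l * i n)
      have h2 := hB n (k n + l * i n + i n)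
      rw [pcount_eq_zero _ (hbig _ hl')] at h1
      rw [pcount_eq_zero _ ((hbig _ hl').trans_le (Nat.le_add_right _ _))] at h2
      rw [← h]
      omega
    simp [h0]

lemma tendsto_add_const_div_sqrt {J : ℕ → ℕ} {y : ℝ}
    (hJ : Tendsto (fun n => (J n : ℝ) / √n) atTop (𝓝 y)) (a : ℕ) :
    Tendsto (fun n => ((J n + a : ℕ) : ℝ) / √n) atTop (𝓝 y) := by
  have h1 := hJ.add ((tendsto_inv_atTop_zero.comp tendsto_sqrt_natCast_atTop).const_mul (a : ℝ))
  rw [mul_zero, add_zero] at h1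
  refine h1.congr fun n => ?_
  simp only [Function.comp]
  push_cast; ring

lemma Ico_add_succ (J w : ℕ) :
    Finset.Ico J (J + (w + 1)) = insert (J + w) (Finset.Ico J (J + w)) := by
  ext x; simp only [Finset.mem_Ico, Finset.mem_insert]; omega

/-- In the limit each integer near `y√n` is a part with probability `x/(1+x)`, independently:
exactly `l` of the `w` window integers occur, and `m` occurs. The induction grows the window towards
the fixed `m = J + a`; `w ≤ a` keeps `m` outside it. -/
lemma hasShiftLim_distinctHook {J : ℕ → ℕ} {y : ℝ} (hy : 0 < y) (hJ0 : ∀ n, 0 < J n)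
    (hJ : Tendsto (fun n => (J n : ℝ) / √n) atTop (𝓝 y)) (a w : ℕ) (hw : w ≤ a) (l : ℕ) :
    HasShiftLim (fun n k => distinctHook (Finset.Ico (J n) (J n + w)) (J n + a) l n k)
      (w.choose l * Real.exp (-rateConst * y) ^ (l + 1) /
        (1 + Real.exp (-rateConst * y)) ^ (w + 1)) := by
  set x := Real.exp (-rateConst * y) with hx
  have hx0 : 0 < 1 + x := by have := Real.exp_pos (-rateConst * y); linarith
  induction w generalizing l with
  | zero =>
    simp only [add_zero, Finset.Ico_self]
    cases l with
    | zero =>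
      have hm := tendsto_add_const_div_sqrt hJ a
      have h1 : HasShiftLim (fun n k => pcount (fun s => s.Nodup ∧ J n + a ∉ s) n k)
          (1 / (1 + x)) := by
        refine hasShiftLim_pcount.of_add_shift_eq hy hm (fun n k => ?_) (fun n k => ?_)
        · rw [← pcount_nodup_eq]
          exact pcount_mono _ _ fun s hs => hs.1
        · rw [← pcount_nodup_eq]
          refine pcount_avoid_add (P := Multiset.Nodup) (by have := hJ0 n; omega) (fun s => ?_) n k
          rw [Multiset.nodup_cons, and_comm]
      have h2 := (h1.shift hm).congr fun n k =>
        distinctHook_empty_zero (m := J n + a) (by have := hJ0 n; omega) n k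
      convert h2 using 1
      rw [← hx]
      simp
      ring
    | succ l =>
      have h1 := hasShiftLim_zero.congr fun n k => distinctHook_empty_succ (J n + a) l n k
      convert h1 using 1
      simp
  | succ w ih =>
    have hi := tendsto_add_const_div_sqrt hJ w
    have hav : ∀ l, HasShiftLim (fun n k => distinctHookAvoid (J n + w)
        (Finset.Ico (J n) (J n + w)) (J n + a) l n k)
        (w.choose l * x ^ (l + 1) / (1 + x) ^ (w + 1) / (1 + x)) := fun l =>
      (ih (by omega) l).of_add_shift_eq hy hi (fun n k => distinctHookAvoid_le _ _ _ _ _ _)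
        fun n k => distinctHookAvoid_add (by have := hJ0 n; omega) (by simp) (by omega) l n k
    simp only [Ico_add_succ]
    cases l with
    | zero =>
      have h1 := (hav 0).congr fun n k => distinctHook_insert_zero (m := J n + a)
        (by have := hJ0 n; omega : 0 < J n + w) (Finset.Ico (J n) (J n + w)) n k
      convert h1 using 1
      simp only [Nat.choose_zero_right, div_div, ← pow_succ]
    | succ l =>
      have h1 := ((hav (l + 1)).add ((hav l).shift hi)).congr fun n k =>
        distinctHook_insert_succ (m := J n + a) (by have := hJ0 n; omega : 0 < J n + w)
          (Finset.Ico (J n) (J n + w)) (by omega) l n k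
      convert h1 using 1
      rw [← hx, Nat.choose_succ_succ]
      push_cast
      field_simp
      ring

/-- In the limit multiplicities are independent geometric variables with ratio `x`. The exponent `(w
+ e) / 2` is the number of odd integers in the window, `e` being the parity of its left end; even
integers change nothing. -/
lemma hasShiftLim_oddHook {J : ℕ → ℕ} {y : ℝ} {e : ℕ} (hJe : ∀ n, J n % 2 = e)
    (hJ : Tendsto (fun n => (J n : ℝ) / √n) atTop (𝓝 y)) (a : ℕ) (ha : (e + a) % 2 = 1)
    (w : ℕ) (hw : w ≤ a) (l : ℕ) :
    HasShiftLim (fun n k => oddHook (Finset.Ico (J n) (J n + w)) (J n + a) l n k)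
      ((l + (w + e) / 2).choose l * Real.exp (-rateConst * y) ^ (l + 1) *
        (1 - Real.exp (-rateConst * y)) ^ ((w + e) / 2)) := by
  set x := Real.exp (-rateConst * y) with hx
  have he : e < 2 := by rw [← hJe 0]; exact Nat.mod_lt _ two_pos
  induction w generalizing l with
  | zero =>
    simp only [add_zero, Finset.Ico_self, zero_add, Nat.div_eq_of_lt he, Nat.choose_self, pow_zero,
      Nat.cast_one, one_mul, mul_one]
    have hm := tendsto_add_const_div_sqrt hJ a
    have hm' : Tendsto (fun n => (((l + 1) * (J n + a) : ℕ) : ℝ) / √n) atTop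
        (𝓝 (((l + 1 : ℕ) : ℝ) * y)) := by
      refine (hm.const_mul ((l + 1 : ℕ) : ℝ)).congr fun n => ?_
      push_cast; ring
    have h1 := (hasShiftLim_pcount.shift hm').congr fun n k => oddHook_empty (m := J n + a)
      (by rw [Nat.odd_iff]; have := hJe n; omega) l n k
    convert h1 using 1
    rw [one_mul, hx, ← Real.exp_nat_mul]
    ring_nf
  | succ w ih =>
    have hi := tendsto_add_const_div_sqrt hJ w
    simp only [Ico_add_succ]
    by_cases hodd : (w + e) % 2 = 1
    · have hio : ∀ n, Odd (J n + w) := fun n => by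
        rw [Nat.odd_iff]; have := hJe n; omega
      have hdiv : (w + 1 + e) / 2 = (w + e) / 2 + 1 := by omega
      rw [hdiv]
      set b := (w + e) / 2 with hb
      have hwa : w ≤ a := by omega
      -- The recursion for an odd integer refers to the enlarged window at index `l`, hence an inner
      -- induction on `l`; Pascal's rule closes it.
      induction l with
      | zero =>
        have h1 := (ih hwa 0).of_add_eq ((ih hwa 0).shift hi) fun n k =>
          oddHook_insert_zero (m := J n + a) (hio n) (W := Finset.Ico (J n) (J n + w)) (by simp)
            (by omega) n k
        convert h1 using 1
        simp only [Nat.choose_zero_right, ← hx]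
        ring
      | succ l ihl =>
        have h1 := ((ih hwa (l + 1)).add (ihl.shift hi)).of_add_eq ((ih hwa (l + 1)).shift hi)
          fun n k => oddHook_insert_succ (m := J n + a) (hio n)
            (W := Finset.Ico (J n) (J n + w)) (by simp) (by omega) l n k
        convert h1 using 1
        have hch : (l + 1 + (b + 1)).choose (l + 1) =
            (l + (b + 1)).choose l + (l + 1 + b).choose (l + 1) := by
          rw [show l + 1 + (b + 1) = (l + (b + 1)) + 1 by ring, Nat.choose_succ_succ]
          congr 2
          ring
        rw [hch, ← hx]
        push_cast
        ring
    · have hdiv : (w + 1 + e) / 2 = (w + e) / 2 := by omega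
      rw [hdiv]
      refine (ih (by omega) l).congr fun n k => oddHook_insert_even ?_ _ _ _ _ _
      rw [Nat.odd_iff]; have := hJe n; omega

/-! ### Summation over the columns -/

lemma tendsto_hook_sum {F : ℕ → ℕ → ℝ} (hF0 : ∀ n r, 0 ≤ F n r)
    (hF : ∀ n r, F n r ≤ oddRatio n (r + 1)) {φ : ℝ → ℝ}
    (hlim : ∀ z, 0 < z → Tendsto (fun n : ℕ => F n ⌊z * √(n : ℝ)⌋₊) atTop (𝓝 (φ z))) :
    Tendsto (fun n : ℕ => (√(n : ℝ))⁻¹ * ∑ r ∈ Finset.range n, F n r) atTop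
      (𝓝 (∫ z in Set.Ioi (0 : ℝ), φ z)) := by
  refine tendsto_riemannSum (tendsto_sqrt_natCast_atTop.eventually_gt_atTop 0) (N := fun n => n)
    (fun n r hr => ?_) (bound := fun z => 3 * Real.exp (-(1 / 8) * z)) ?_ ?_
    (Eventually.of_forall hlim)
  · refine le_antisymm ((hF n r).trans_eq (oddRatio_eq_zero (by omega))) (hF0 n r)
  · exact (integrableOn_exp_neg (b := 1 / 8) (by norm_num)).const_mul 3
  · filter_upwards [tendsto_sqrt_natCast_atTop.eventually_gt_atTop 0] with n hn z hz
    rw [abs_of_nonneg (hF0 _ _)]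
    refine (hF _ _).trans ((oddRatio_le_exp _ _).trans ?_)
    refine mul_le_mul_of_nonneg_left (Real.exp_le_exp.2 ?_) (by norm_num)
    rw [neg_mul, neg_le_neg_iff, le_div_iff₀ (by positivity)]
    have := Nat.lt_floor_add_one (z * √(n : ℝ))
    push_cast
    linarith

lemma tendsto_distinctHook_sum (a l : ℕ) :
    Tendsto (fun n : ℕ => (√(n : ℝ))⁻¹ * ∑ j ∈ Finset.range n,
      (distinctHook (Finset.Ico (j + 1) (j + 1 + a)) (j + 1 + a) l n 0 : ℝ) / pcount AllOdd n 0)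
      atTop (𝓝 (rateConst⁻¹ * (a.choose l * integralB (l + 1) (a + 1)))) := by
  have hint : ∫ z in Set.Ioi (0 : ℝ), a.choose l * Real.exp (-rateConst * z) ^ (l + 1) /
      (1 + Real.exp (-rateConst * z)) ^ (a + 1) =
      rateConst⁻¹ * (a.choose l * integralB (l + 1) (a + 1)) := by
    have h1 := integral_comp_mul_left_Ioi (fun x => Real.exp (-((l + 1 : ℕ) : ℝ) * x) /
      (1 + Real.exp (-x)) ^ (a + 1)) 0 rateConst_pos
    rw [mul_zero, smul_eq_mul] at h1
    rw [integralB, mul_left_comm, ← h1, ← integral_const_mul]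
    refine integral_congr_ae (Eventually.of_forall fun z => ?_)
    simp only
    rw [← Real.exp_nat_mul, mul_div_assoc]
    ring_nf
  rw [← hint]
  refine tendsto_hook_sum (fun n r => by positivity) (fun n r => ?_) (fun z hz => ?_)
  · refine div_le_div_of_nonneg_right (Nat.cast_le.2 ?_) (Nat.cast_nonneg _)
    refine (distinctHook_le (by omega) _ _ _ _).trans (pcount_allOdd_antitone n (by omega))
  · have hJ := tendsto_add_const_div_sqrt
      (tendsto_natFloor_mul_div tendsto_sqrt_natCast_atTop hz.le) 1
    have h1 := hasShiftLim_distinctHook hz (fun n => Nat.succ_pos _) hJ a a le_rfl l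
      (fun _ => 0) 0 (by simp)
    simpa using h1

lemma tendsto_oddHook_sum (a l : ℕ) :
    Tendsto (fun n : ℕ => (√(n : ℝ))⁻¹ * ∑ j ∈ Finset.range n,
      (oddHook (Finset.Ico (j + 1) (j + 1 + a)) (j + 1 + a) l n 0 : ℝ) / pcount AllOdd n 0)
      atTop (𝓝 (rateConst⁻¹ * ((l + a / 2).choose l * integralA (a / 2) (2 * (l + 1))))) := by
  have hint : ∫ z in Set.Ioi (0 : ℝ), (l + a / 2).choose l *
      Real.exp (-rateConst * (2 * z)) ^ (l + 1) * (1 - Real.exp (-rateConst * (2 * z))) ^ (a / 2) =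
      rateConst⁻¹ * ((l + a / 2).choose l * integralA (a / 2) (2 * (l + 1))) := by
    have h1 := integral_comp_mul_left_Ioi (fun x => (1 - Real.exp (-2 * x)) ^ (a / 2) *
      Real.exp (-((2 * (l + 1) : ℕ) : ℝ) * x)) 0 rateConst_pos
    rw [mul_zero, smul_eq_mul] at h1
    rw [integralA, mul_left_comm, ← h1, ← integral_const_mul]
    refine integral_congr_ae (Eventually.of_forall fun z => ?_)
    simp only
    rw [← Real.exp_nat_mul, mul_assoc, mul_comm (Real.exp _)]
    push_cast
    ring_nf
  rw [← hint]
  -- only every second index contributes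
  set e := a % 2 with he
  have he2 : e < 2 := Nat.mod_lt _ two_pos
  set G : ℕ → ℕ → ℝ := fun n j =>
    (oddHook (Finset.Ico (j + 1) (j + 1 + a)) (j + 1 + a) l n 0 : ℝ) / pcount AllOdd n 0 with hG
  have hGle : ∀ n j, G n j ≤ oddRatio n (j + 1) := fun n j => by
    refine div_le_div_of_nonneg_right (Nat.cast_le.2 ?_) (Nat.cast_nonneg _)
    exact (oddHook_le (by omega) _ _ _ _).trans (pcount_allOdd_antitone n (by omega))
  have hG0 : ∀ n j, 0 ≤ G n j := fun n j => by positivity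
  -- The part `m = j + 1 + a` is odd only for `j ≡ a` mod 2, so `j = 2r + e`. Letting `r` run to `n`
  -- only adds vanishing terms. Now `j ~ 2z√n`, the source of the factor 2 in the exponents of
  -- `integralA`.
  have hsum : ∀ n, ∑ j ∈ Finset.range n, G n j = ∑ r ∈ Finset.range n, G n (2 * r + e) := by
    intro n
    rw [← Finset.sum_image (s := Finset.range n) (g := fun r => 2 * r + e) (f := fun j => G n j)
      (by intro a _ b _ h; dsimp only at h; omega)]
    have hz : ∀ j, n ≤ j → G n j = 0 := fun j hj =>
      le_antisymm ((hGle n j).trans_eq (oddRatio_eq_zero (by omega))) (hG0 n j)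
    have h1 : ∑ j ∈ Finset.range n, G n j =
        ∑ j ∈ Finset.range n ∪ (Finset.range n).image (fun r => 2 * r + e), G n j := by
      refine Finset.sum_subset Finset.subset_union_left fun j _ hj => hz j ?_
      simpa using hj
    rw [h1]
    symm
    refine Finset.sum_subset Finset.subset_union_right fun j hj hj' => ?_
    by_cases hjn : n ≤ j
    · exact hz j hjn
    have hpar : j % 2 ≠ e := by
      intro hpar
      refine hj' (Finset.mem_image.2 ⟨j / 2, Finset.mem_range.2 (by omega), by omega⟩)
    simp only [hG]
    rw [oddHook_of_even (by rw [Nat.odd_iff]; omega)]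
    simp
  refine Tendsto.congr (fun n => by rw [hsum n]) (tendsto_hook_sum
    (F := fun n r => G n (2 * r + e)) (fun n r => hG0 _ _) (fun n r => ?_) (fun z hz => ?_))
  · exact (hGle _ _).trans (oddRatio_antitone n (by omega))
  · have hfl := tendsto_natFloor_mul_div tendsto_sqrt_natCast_atTop hz.le
    have hJ : Tendsto (fun n : ℕ => ((2 * ⌊z * √(n : ℝ)⌋₊ + (e + 1) : ℕ) : ℝ) / √n) atTop
        (𝓝 (2 * z)) := by
      refine tendsto_add_const_div_sqrt (J := fun n : ℕ => 2 * ⌊z * √(n : ℝ)⌋₊) ?_ (e + 1)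
      refine (hfl.const_mul 2).congr fun n => ?_
      push_cast; ring
    have h1 := hasShiftLim_oddHook (e := (e + 1) % 2) (fun n => by omega) hJ a (by omega) a le_rfl l
      (fun _ => 0) 0 (by simp)
    have hdiv : (a + (e + 1) % 2) / 2 = a / 2 := by omega
    rw [hdiv, mul_zero, Real.exp_zero, mul_one] at h1
    exact h1

/-! ### Identification of the constants and conclusion -/

lemma sum_range_even_odd (G : ℕ → ℝ) (h : ℕ) :
    ∑ a ∈ Finset.range h, G a =
      ∑ b ∈ Finset.range ((h + 1) / 2), G (2 * b) + ∑ b ∈ Finset.range (h / 2), G (2 * b + 1) := by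
  induction h with
  | zero => simp
  | succ h ih =>
    rw [Finset.sum_range_succ, ih]
    rcases Nat.even_or_odd' h with ⟨c, rfl | rfl⟩
    · rw [show (2 * c + 1 + 1) / 2 = c + 1 by omega, show (2 * c + 1) / 2 = c by omega,
        show 2 * c / 2 = c by omega, Finset.sum_range_succ]
      ring
    · rw [show (2 * c + 1 + 1 + 1) / 2 = c + 1 by omega, show (2 * c + 1 + 1) / 2 = c + 1 by omega,
        show (2 * c + 1) / 2 = c by omega, Finset.sum_range_succ (fun b => G (2 * b + 1))]
      ring

/-- The two sums in `hookAlpha` are the contributions of even and odd arm lengths, with `j = ⌊a/2⌋`.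
-/
lemma hookAlpha_eq_sum (h : ℕ) :
    ∑ a ∈ Finset.range h, ((h - a - 1 + a / 2).choose (h - a - 1) : ℝ) *
      integralA (a / 2) (2 * (h - a - 1 + 1)) = hookAlpha h := by
  rw [sum_range_even_odd, hookAlpha]
  congr 1
  · refine Finset.sum_congr rfl fun b hb => ?_
    have hb' := Finset.mem_range.1 hb
    rw [show 2 * b / 2 = b by omega, show 2 * (h - 2 * b - 1 + 1) = 2 * h - 4 * b by omega,
      Nat.choose_symm_add, show h - 2 * b - 1 + b = h - b - 1 by omega]
  · refine Finset.sum_congr rfl fun b hb => ?_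
    have hb' := Finset.mem_range.1 hb
    rw [show (2 * b + 1) / 2 = b by omega,
      show 2 * (h - (2 * b + 1) - 1 + 1) = 2 * h - 4 * b - 2 by omega,
      Nat.choose_symm_add, show h - (2 * b + 1) - 1 + b = h - b - 2 by omega]

/-- The index `j` of `hookBeta` is the leg length `h - a - 1`; legs longer than the arm have
binomial coefficient zero. -/
lemma hookBeta_eq_sum (h : ℕ) :
    ∑ a ∈ Finset.range h, (a.choose (h - a - 1) : ℝ) * integralB (h - a - 1 + 1) (a + 1) =
      hookBeta h := by
  rw [← Finset.sum_range_reflect, hookBeta]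
  symm
  refine Finset.sum_subset_zero_on_sdiff (Finset.range_subset_range.2 (by omega)) ?_ ?_
  · intro j hj
    rw [Finset.mem_sdiff, Finset.mem_range, Finset.mem_range] at hj
    rw [Nat.choose_eq_zero_of_lt (by omega)]
    simp
  · intro j hj
    have hj' := Finset.mem_range.1 hj
    rw [show h - 1 - j = h - j - 1 by omega, show h - (h - j - 1) - 1 = j by omega,
      show h - j - 1 + 1 = h - j by omega]

lemma integralA_nonneg (j l : ℕ) : 0 ≤ integralA j l := by
  refine setIntegral_nonneg measurableSet_Ioi fun x hx => ?_
  have hx0 : 0 < x := hx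
  have : Real.exp (-2 * x) ≤ 1 := Real.exp_le_one_iff.2 (by linarith)
  have : 0 ≤ 1 - Real.exp (-2 * x) := by linarith
  positivity

lemma integralB_nonneg (j k : ℕ) : 0 ≤ integralB j k :=
  setIntegral_nonneg measurableSet_Ioi fun x _ => by positivity

lemma hookAlpha_pos {h : ℕ} (hh : 1 ≤ h) : 0 < hookAlpha h := by
  have h0 : 0 < integralA 0 (2 * h) := by
    have h1 : integralA 0 (2 * h) = 1 / ((2 * h : ℕ) : ℝ) := by
      have hneg : -((2 * h : ℕ) : ℝ) < 0 := by
        rw [neg_lt_zero]; exact_mod_cast (by omega : 0 < 2 * h)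
      have h2 := integral_exp_mul_Ioi hneg 0
      simp only [integralA, pow_zero, one_mul]
      rw [h2, mul_zero, Real.exp_zero, neg_div_neg_eq]
    rw [h1]
    have : (0 : ℝ) < ((2 * h : ℕ) : ℝ) := by exact_mod_cast (by omega : 0 < 2 * h)
    positivity
  refine add_pos_of_pos_of_nonneg ?_
    (Finset.sum_nonneg fun j _ => mul_nonneg (Nat.cast_nonneg _) (integralA_nonneg _ _))
  refine Finset.sum_pos' (fun j _ => mul_nonneg (Nat.cast_nonneg _) (integralA_nonneg _ _))
    ⟨0, Finset.mem_range.2 (by omega), ?_⟩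
  simpa using h0

lemma hookBeta_pos {h : ℕ} (hh : 1 ≤ h) : 0 < hookBeta h := by
  have h0 : 0 < integralB 1 h := by
    have hle : ∀ x : ℝ, Real.exp (-((1 : ℕ) : ℝ) * x) / (1 + Real.exp (-x)) ^ h ≤
        Real.exp (-1 * x) := fun x => by
      have h1 : 1 ≤ (1 + Real.exp (-x)) ^ h := one_le_pow₀ (by have := Real.exp_pos (-x); linarith)
      simpa using div_le_self (Real.exp_pos (-((1 : ℕ) : ℝ) * x)).le h1
    have hi : IntegrableOn (fun x : ℝ => Real.exp (-((1 : ℕ) : ℝ) * x) / (1 + Real.exp (-x)) ^ h)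
        (Set.Ioi 0) := by
      refine Integrable.mono' (integrableOn_exp_neg one_pos) ?_ (Eventually.of_forall fun x => ?_)
      · refine Continuous.aestronglyMeasurable ?_
        refine Continuous.div (by fun_prop) (by fun_prop) fun x => ?_
        positivity
      · rw [Real.norm_eq_abs, abs_of_nonneg (by positivity)]
        exact hle x
    rw [integralB, setIntegral_pos_iff_support_of_nonneg_ae
      (Eventually.of_forall fun x => by simp only [Pi.zero_apply]; positivity) hi]
    have hs : Function.support (fun x : ℝ => Real.exp (-((1 : ℕ) : ℝ) * x) /
        (1 + Real.exp (-x)) ^ h) = Set.univ := by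
      refine Set.eq_univ_of_forall fun x => ?_
      rw [Function.mem_support]
      positivity
    rw [hs, Set.univ_inter, Real.volume_Ioi]
    exact ENNReal.zero_lt_top
  refine Finset.sum_pos' (fun j _ => mul_nonneg (Nat.cast_nonneg _) (integralB_nonneg _ _))
    ⟨0, Finset.mem_range.2 (by omega), ?_⟩
  simpa using h0

/-- The constants match because `1/c = 2√3/π = 6/(π√3)`. Positivity of `A` makes the limit nonzero,
as asymptotic equivalence needs. -/
lemma isEquivalent_of_tendsto_div_sqrt {u : ℕ → ℝ} {A : ℝ} (hA : 0 < A)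
    (hu : Tendsto (fun n : ℕ => (√(n : ℝ))⁻¹ * u n) atTop (𝓝 (rateConst⁻¹ * A))) :
    Asymptotics.IsEquivalent atTop u
      (fun n : ℕ => 6 * A / Real.pi * Real.sqrt ((n : ℝ) / 3)) := by
  have hc := rateConst_pos
  have hv : ∀ n : ℕ, 6 * A / Real.pi * √((n : ℝ) / 3) = rateConst⁻¹ * A * √n := by
    intro n
    rw [Real.sqrt_div (Nat.cast_nonneg n), rateConst]
    have h30 : (0 : ℝ) < √3 := by positivity
    field_simp
    rw [Real.sq_sqrt (by norm_num)]
    ring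
  simp_rw [hv]
  rw [Asymptotics.isEquivalent_iff_tendsto_one]
  · have h1 := hu.div_const (rateConst⁻¹ * A)
    rw [div_self (by positivity)] at h1
    refine h1.congr fun n => ?_
    simp only [Pi.div_apply]
    rw [inv_mul_eq_div, div_div, mul_comm]
  · filter_upwards [tendsto_sqrt_natCast_atTop.eventually_gt_atTop 0] with n hn
    positivity

theorem mainTheorem11 (h : ℕ) (hh : 1 ≤ h) :
    Asymptotics.IsEquivalent Filter.atTop
      (fun n : ℕ => avgHooks (Nat.Partition.odds n) h)
      (fun n : ℕ => 6 * hookAlpha h / Real.pi * Real.sqrt ((n : ℝ) / 3)) ∧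
    Asymptotics.IsEquivalent Filter.atTop
      (fun n : ℕ => avgHooks (Nat.Partition.distincts n) h)
      (fun n : ℕ => 6 * hookBeta h / Real.pi * Real.sqrt ((n : ℝ) / 3)) := by
  classical
  constructor
  · refine isEquivalent_of_tendsto_div_sqrt (hookAlpha_pos hh) ?_
    rw [← hookAlpha_eq_sum, Finset.mul_sum]
    refine (tendsto_finsetSum _ fun a _ => tendsto_oddHook_sum a (h - a - 1)).congr fun n => ?_
    rw [avgHooks, card_odds, odds_eq_filter, ← Nat.cast_sum, sum_hookCount AllOdd,
      ← Finset.mul_sum]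
    push_cast
    rw [Finset.sum_div]
    congr 1
    refine Finset.sum_congr rfl fun a _ => ?_
    rw [Finset.sum_div]
    rfl
  · refine isEquivalent_of_tendsto_div_sqrt (hookBeta_pos hh) ?_
    rw [← hookBeta_eq_sum, Finset.mul_sum]
    refine (tendsto_finsetSum _ fun a _ => tendsto_distinctHook_sum a (h - a - 1)).congr fun n => ?_
    rw [avgHooks, ← Nat.Partition.card_odds_eq_card_distincts, card_odds, ← Nat.cast_sum,
      Nat.Partition.distincts, sum_hookCount Multiset.Nodup, ← Finset.mul_sum]
    push_cast
    rw [Finset.sum_div]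
    congr 1
    refine Finset.sum_congr rfl fun a _ => ?_
    rw [Finset.sum_div]
    rfl
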